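/- **Theorem 2 (Complete square complexity).** Let $H=\sum_n\lambda_n|\lambda_n\rangle\langle\lambda_n|$ be a Hamiltonian on a finite-dimensional system register, let $\hat U_{\lambda}$ be a unitary preparing an eigenstate $|\lambda_{\mathrm{in}}\rangle=\hat U_\lambda|0\rangle$, and let $V^{(0)},\dots,V^{(D)}$ be operators given through unitaries $\hat U_{V^{(j)}}$ that block-encode $V^{(j)}/|V^{(j)}|_1$, with $|V^{(j)}|_1>0$. Put $\Omega=\prod_{j=0}^D|V^{(j)}|_1$. For $N=2^m$ and a window $\mathcal L(x)=N^{-1/2}\sum_{k=0}^{N-1}\alpha_k e^{ikx}$ with $\sum_k|\alpha_k|^2=1$, the complete-square response (of order $2D+1$) is $$R^{(2)}(\vec\omega)=\Bigl\|\sum_{n_0,\dots,n_D}V^{(D)}_{n_D\,\mathrm{in}}\prod_{j=1}^{D}V^{(j-1)}_{n_{j-1}n_j}\,\mathcal L\bigl(\lambda_{n_{j-1}}-\lambda_{n_j}-\omega_{D-j+1}\bigr)\,|\lambda_{n_0}\rangle\Bigr\|^2,\qquad V^{(j)}_{nn'}=\langle\lambda_n|V^{(j)}|\lambda_{n'}\rangle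 .$$ Let $\eta,\epsilon\in(0,1)$ and fix an allowed failure probability $\delta\in(0,1)$; the constants below depend only on $\delta$. There is a window of energy resolution $\eta$ (phase estimation with it errs by more than $\eta$ modulo $2\pi$ with probability at most $\epsilon/(D+1)$) with $N=O(\log(2(D+1)/\epsilon)/\eta)$. For every window with $N=O(\log(2(D+1)/\epsilon)/\eta)=\tilde O(1/\eta)$ the following holds. Consider the circuit with only $D$ frequency registers of $m$ qubits that prepares $\sum_k\alpha_k|k\rangle$ in each register and $|\lambda_{\mathrm{in}}\rangle$ in the system, applies $V^{(0)}_I(t_D)V^{(1)}_I(t_{D-1})\cdots V^{(D-1)}_I(t_1)V^{(D)}$, where $V_I(t)=e^{iHt}Ve^{-iHt}$, multiplexed over the register values $t_j$ and with the block-encodings in place of the operators, and applies the inverse quantum Fourier transform to each register. The probability $P(\vec\omega)$ of measuring $\vec\omega\in\{0,\dots,N-1\}^D$ in the registers together with success of all block-encodings satisfies $R^{(2)}(2\pi\vec\omega/N)=\Omega^2P(\vec\omega)$. Moreover, with probability at least $1-\delta$, $R^{(2)}$ can be estimated to accuracy $\epsilon$ by either of the following procedures, which use only queries to the (controlled) $e^{\pm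 iH}$, the $\hat U_{V^{(j)}}$, $\hat U_\lambda$ and their inverses: 1. At one point $\vec\omega\in\mathbb R^D$, with $O(1)$ samples and in total $\tilde O\bigl(D\Omega^2/(\eta\epsilon)\bigr)$ queries to $e^{\pm iH}$ and $O(\Omega^2/\epsilon)$ queries to each $\hat U_{V^{(j)}}$ and to $\hat U_\lambda$. 2. At all points $2\pi\vec\omega/N$ simultaneously, by directly sampling the circuit above $O(\Omega^4/\epsilon^2)$ times and multiplying the observed frequencies by $\Omega^2$. Each circuit uses $\tilde O(D/\eta)$ queries to $e^{\pm iH}$ and $O(1)$ queries to each $\hat U_{V^{(j)}}$ and to $\hat U_\lambda$; in total there are $\tilde O\bigl(D\Omega^4/(\eta\epsilon^2)\bigr)$ queries to $e^{\pm iH}$ and $O(\Omega^4/\epsilon^2)$ queries to each $\hat U_{V^{(j)}}$ and to $\hat U_\lambda$. Here $\tilde O$ hides only a factor $\log(2(D+1)/\epsilon)$. -/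

import Mathlib

open scoped Matrix Kronecker

namespace GQPE

/-! ### The problem data and the target quantity -/

/-- A problem instance on a `d`-dimensional system register, with `D + 1` operators `V⁽⁰⁾, …, V⁽ᴰ⁾`
whose block-encodings have normalisations `a j` (the 1-norms of `V⁽ʲ⁾`) and ancilla registers of
dimension `b j`.
* `lam n`, `ket n`: eigenvalues and orthonormal eigenvectors of the Hamiltonian;
* `n0`: the initial eigenstate, prepared by the unitary `Uprep` from the basis state `0`;
* `UV j`: a unitary on ancilla and system whose block at ancilla state `0` is `V⁽ʲ⁾ / a j`. -/
structure Problem (D d : ℕ) [NeZero d] (b : Fin (D + 1) → ℕ) [∀ j, NeZero (b j)]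
    (a : Fin (D + 1) → ℝ) where
  lam : Fin d → ℝ
  ket : OrthonormalBasis (Fin d) ℂ (EuclideanSpace ℂ (Fin d))
  n0 : Fin d
  V : Fin (D + 1) → Matrix (Fin d) (Fin d) ℂ
  UV : (j : Fin (D + 1)) → Matrix.unitaryGroup (Fin (b j) × Fin d) ℂ
  Uprep : Matrix.unitaryGroup (Fin d) ℂ
  block_encodes : ∀ j s s', (UV j).1 (0, s) (0, s') = V j s s' / (a j : ℂ)
  prepares : ∀ s, Uprep.1 s 0 = ket n0 s

section problem

variable {D d : ℕ} [NeZero d] {b : Fin (D + 1) → ℕ} [∀ j, NeZero (b j)] {a : Fin (D + 1) → ℝ}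

/-- The Hamiltonian `H = ∑ₙ λₙ |λₙ⟩⟨λₙ|`. -/
noncomputable def Problem.H (P : Problem D d b a) : Matrix (Fin d) (Fin d) ℂ :=
  Matrix.of fun s s' => ∑ n, (P.lam n : ℂ) * P.ket n s * star (P.ket n s')

/-- The matrix element `V⁽ʲ⁾ₙₙ' = ⟨λₙ| V⁽ʲ⁾ |λₙ'⟩`. -/
noncomputable def Problem.elem (P : Problem D d b a) (j : Fin (D + 1)) (n n' : Fin d) : ℂ :=
  inner ℂ (P.ket n) (Matrix.toEuclideanLin (P.V j) (P.ket n'))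

/-- The window function `L(x) = N^{-1/2} ∑ₖ αₖ e^{ikx}` with Fourier coefficients `α`. -/
noncomputable def window {N : ℕ} (α : Fin N → ℂ) (x : ℝ) : ℂ :=
  (1 / Real.sqrt N : ℝ) * ∑ k : Fin N, α k * Complex.exp (Complex.I * ((k : ℕ) : ℂ) * (x : ℂ))

/-- The complete-square response
`‖ ∑_{n₀,…,n_D} V⁽ᴰ⁾_{n_D,init} ∏_{j=1}^{D} V⁽ʲ⁻¹⁾_{n_{j-1} n_j} L(λ_{n_{j-1}} - λ_{n_j} - ω_{D-j+1}) |λ_{n₀}⟩ ‖²`.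
Here `init` is the initial eigenstate; frequencies are indexed from `0` in Lean. -/
noncomputable def Problem.R2 (P : Problem D d b a) {N : ℕ} (α : Fin N → ℂ) (ω : Fin D → ℝ) : ℝ :=
  ‖∑ n : Fin (D + 1) → Fin d,
      (P.elem (Fin.last D) (n (Fin.last D)) P.n0 *
        ∏ j : Fin D, P.elem j.castSucc (n j.castSucc) (n j.succ) *
          window α (P.lam (n j.castSucc) - P.lam (n j.succ) - ω (Fin.rev j))) • P.ket (n 0)‖ ^ 2

end problem

/-- The window has energy resolution `η` up to failure probability `ξ`: phase estimation with this
window, applied to a state of energy `θ`, returns a grid frequency `2πk/N` that lies within `η` of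
`θ` modulo `2π`, except with probability at most `ξ`. -/
def HasResolution {N : ℕ} (α : Fin N → ℂ) (η ξ : ℝ) : Prop :=
  ∀ θ : ℝ, 1 - ξ ≤ ∑ k : Fin N,
    open Classical in
    if ∃ z : ℤ, |θ - 2 * Real.pi * (k : ℕ) / N - 2 * Real.pi * z| ≤ η then
      ‖window α (θ - 2 * Real.pi * (k : ℕ) / N)‖ ^ 2 else 0

/-! ### Quantum circuits with oracles -/

/-- Basis states of all registers: work register, block-encoding ancillas, system. -/
abbrev Reg (W : Type) {D : ℕ} (b : Fin (D + 1) → ℕ) (d : ℕ) : Type :=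
  W × ((j : Fin (D + 1)) → Fin (b j)) × Fin d

/-- Gates. `free U` is a unitary that does not involve the oracles. The others are one query each:
`evol false c` is `e^{iH}` and `evol true c` is `e^{-iH}`, both controlled on the condition `c` on
the work register; `block j` and `prep` are the block-encodings and the state preparation, with
`true` for the inverse. -/
inductive Gate (W : Type) [Fintype W] [DecidableEq W] {D : ℕ} (b : Fin (D + 1) → ℕ) (d : ℕ) where
  | free (U : Matrix.unitaryGroup (Reg W b d) ℂ)
  | evol (inv : Bool) (ctrl : W → Bool)
  | block (j : Fin (D + 1)) (inv : Bool)
  | prep (inv : Bool)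

/-- A circuit: its gates in the order in which they are applied. It does not depend on the
problem instance. -/
abbrev Circuit (W : Type) [Fintype W] [DecidableEq W] {D : ℕ} (b : Fin (D + 1) → ℕ) (d : ℕ) :
    Type := List (Gate W b d)

section circuits

variable {W : Type} [Fintype W] [DecidableEq W] {D d : ℕ} {b : Fin (D + 1) → ℕ}

/-- Number of queries to `e^{± iH}`. -/
def evolQueries (C : Circuit W b d) : ℕ :=
  C.countP fun g => match g with
    | .evol _ _ => true
    | _ => false

/-- Number of queries to the block-encoding of `V⁽ʲ⁾` and its inverse. -/
def blockQueries (j : Fin (D + 1)) (C : Circuit W b d) : ℕ :=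
  C.countP fun g => match g with
    | .block i _ => decide (i = j)
    | _ => false

/-- Number of queries to the state preparation and its inverse. -/
def prepQueries (C : Circuit W b d) : ℕ :=
  C.countP fun g => match g with
    | .prep _ => true
    | _ => false

variable [NeZero d] [∀ j, NeZero (b j)] {a : Fin (D + 1) → ℝ}

/-- Action of a gate on a state vector. -/
noncomputable def Gate.apply (P : Problem D d b a) :
    Gate W b d → (Reg W b d → ℂ) → (Reg W b d → ℂ)
  | .free U, ψ => U.1 *ᵥ ψ
  | .evol inv ctrl, ψ => fun x =>
      if ctrl x.1 then
        ∑ s, NormedSpace.exp ((if inv then -Complex.I else Complex.I) • P.H) x.2.2 s *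
          ψ (x.1, x.2.1, s)
      else ψ x
  | .block j inv, ψ => fun x =>
      ∑ y : Fin (b j) × Fin d, (if inv then (P.UV j).1ᴴ else (P.UV j).1) (x.2.1 j, x.2.2) y *
        ψ (x.1, Function.update x.2.1 j y.1, y.2)
  | .prep inv, ψ => fun x =>
      ∑ s, (if inv then P.Uprep.1ᴴ else P.Uprep.1) x.2.2 s * ψ (x.1, x.2.1, s)

/-- The state after the circuit, started with the work register in `w0` and all other registers
in the basis state `0`. -/
noncomputable def output (P : Problem D d b a) (w0 : W) (C : Circuit W b d) : Reg W b d → ℂ :=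
  C.foldl (fun ψ g => g.apply P ψ) (Pi.single (w0, fun _ => 0, 0) 1)

/-- Probability of the outcome `x` when all registers are measured after the circuit. -/
noncomputable def outcomeProb (P : Problem D d b a) (w0 : W) (C : Circuit W b d) (x : Reg W b d) :
    ℝ :=
  ‖output P w0 C x‖ ^ 2

end circuits

open Classical in
/-- Probability of the event `E` for independent outcomes `x t`, distributed according to `p t`. -/
noncomputable def eventProb {X : Type} [Fintype X] {T : ℕ} (p : Fin T → X → ℝ)
    (E : (Fin T → X) → Prop) : ℝ :=
  ∑ x : Fin T → X, if E x then ∏ t, p t (x t) else 0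

/-- A procedure for estimating a real number: finitely many circuits, run once each and measured,
and a classical function of the outcomes. -/
structure Procedure {D : ℕ} (b : Fin (D + 1) → ℕ) (d : ℕ) where
  W : Type
  [fintypeW : Fintype W]
  [decidableEqW : DecidableEq W]
  w0 : W
  samples : ℕ
  circuit : Fin samples → Circuit W b d
  estimate : (Fin samples → Reg W b d) → ℝ

attribute [instance] Procedure.fintypeW Procedure.decidableEqW

/-- Probability that the estimate returned by the procedure is within `ε` of `r`. -/
noncomputable def Procedure.successProb {D d : ℕ} [NeZero d] {b : Fin (D + 1) → ℕ}
    [∀ j, NeZero (b j)] {a : Fin (D + 1) → ℝ} (A : Procedure b d) (P : Problem D d b a)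
    (r ε : ℝ) : ℝ :=
  eventProb (fun t => outcomeProb P A.w0 (A.circuit t)) fun x => |A.estimate x - r| ≤ ε

/-! ### The circuit for the complete square -/

/-- The tensor power `U ⊗ ⋯ ⊗ U` on `D` registers. -/
def tensorPow (D : ℕ) {N : ℕ} (U : Matrix (Fin N) (Fin N) ℂ) :
    Matrix (Fin D → Fin N) (Fin D → Fin N) ℂ :=
  Matrix.of fun w w' => ∏ i, U (w i) (w' i)

theorem tensorPow_mem (D : ℕ) {N : ℕ} (U : Matrix (Fin N) (Fin N) ℂ)
    (hU : U ∈ Matrix.unitaryGroup (Fin N) ℂ) :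
    tensorPow D U ∈ Matrix.unitaryGroup (Fin D → Fin N) ℂ := by
  rw [Matrix.mem_unitaryGroup_iff] at hU ⊢
  have h : ∀ i j, ∑ k, U i k * star (U j k) = (1 : Matrix (Fin N) (Fin N) ℂ) i j := by
    intro i j
    rw [← hU]
    simp [Matrix.mul_apply, Matrix.star_apply]
  ext w v
  have h1 : (tensorPow D U * star (tensorPow D U)) w v
      = ∑ x : Fin D → Fin N, ∏ i, U (w i) (x i) * star (U (v i) (x i)) := by
    simp [Matrix.mul_apply, Matrix.star_apply, tensorPow, Finset.prod_mul_distrib]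
  rw [h1, ← Fintype.prod_sum (fun i k => U (w i) k * star (U (v i) k))]
  simp_rw [h, Matrix.one_apply]
  rw [Fintype.prod_ite_zero]
  simp [funext_iff]

/-- A unitary applied to each of the `D` time registers. -/
def onTime {D N : ℕ} (b : Fin (D + 1) → ℕ) (d : ℕ) (U : Matrix.unitaryGroup (Fin N) ℂ) :
    Matrix.unitaryGroup (Reg (Fin D → Fin N) b d) ℂ :=
  ⟨tensorPow D U.1 ⊗ₖ (1 : Matrix (((j : Fin (D + 1)) → Fin (b j)) × Fin d) _ ℂ),
    Matrix.kronecker_mem_unitary (tensorPow_mem D U.1 U.2) (one_mem _)⟩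

/-- The inverse Fourier transform `|t⟩ ↦ N^{-1/2} ∑_ω e^{-2πi tω/N} |ω⟩`, as a matrix. -/
noncomputable def invQFTMatrix (N : ℕ) : Matrix (Fin N) (Fin N) ℂ :=
  Matrix.of fun ω t => (1 / Real.sqrt N : ℝ) *
    Complex.exp (-(2 * Real.pi * Complex.I * ((t : ℕ) : ℂ) * ((ω : ℕ) : ℂ) / (N : ℂ)))

theorem invQFTMatrix_mem (N : ℕ) : invQFTMatrix N ∈ Matrix.unitaryGroup (Fin N) ℂ := by
  rw [Matrix.mem_unitaryGroup_iff]
  ext w v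
  have hN : N ≠ 0 := fun h => by subst h; exact w.elim0
  have hNC : (N : ℂ) ≠ 0 := Nat.cast_ne_zero.mpr hN
  set z : ℂ := Complex.exp (2 * Real.pi * Complex.I / N) with hz
  have hprim : IsPrimitiveRoot z N := Complex.isPrimitiveRoot_exp N hN
  have hz0 : z ≠ 0 := Complex.exp_ne_zero _
  set ζ : ℂ := z ^ (v : ℕ) * (z ^ (w : ℕ))⁻¹ with hζ
  have hterm : ∀ t : Fin N, invQFTMatrix N w t * star (invQFTMatrix N v t)
      = (N : ℂ)⁻¹ * ζ ^ (t : ℕ) := by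
    intro t
    have hs : ((1 / Real.sqrt N : ℝ) : ℂ) * ((1 / Real.sqrt N : ℝ) : ℂ) = (N : ℂ)⁻¹ := by
      rw [← Complex.ofReal_mul, div_mul_div_comm, Real.mul_self_sqrt (Nat.cast_nonneg N)]
      simp
    have he : Complex.exp (-(2 * Real.pi * Complex.I * ((t : ℕ) : ℂ) * ((w : ℕ) : ℂ) / (N : ℂ))) *
        star (Complex.exp (-(2 * Real.pi * Complex.I * ((t : ℕ) : ℂ) * ((v : ℕ) : ℂ) / (N : ℂ))))
        = ζ ^ (t : ℕ) := by
      rw [hζ, hz, mul_pow, inv_pow, ← Complex.exp_nat_mul, ← Complex.exp_nat_mul,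
        ← Complex.exp_nat_mul, ← Complex.exp_nat_mul, ← Complex.exp_neg, ← Complex.exp_add,
        Complex.star_def, ← Complex.exp_conj, ← Complex.exp_add]
      congr 1
      simp only [map_neg, map_div₀, map_mul, Complex.conj_I, Complex.conj_ofReal, map_natCast,
        map_ofNat]
      ring
    rw [← he, ← hs]
    simp only [invQFTMatrix, Matrix.of_apply, star_mul', Complex.star_def, Complex.conj_ofReal]
    ring
  have hsum : (invQFTMatrix N * star (invQFTMatrix N)) w v
      = (N : ℂ)⁻¹ * ∑ t ∈ Finset.range N, ζ ^ t := by
    rw [Matrix.mul_apply, Finset.mul_sum, ← Fin.sum_univ_eq_sum_range (fun t => (N : ℂ)⁻¹ * ζ ^ t)]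
    exact Finset.sum_congr rfl fun t _ => hterm t
  rw [hsum, Matrix.one_apply]
  split_ifs with hwv
  · subst hwv
    have h1 : ζ = 1 := mul_inv_cancel₀ (pow_ne_zero _ hz0)
    simp [h1, hNC]
  · have hne : ζ - 1 ≠ 0 := by
      intro h
      have h2 : z ^ (v : ℕ) = z ^ (w : ℕ) :=
        (mul_inv_eq_one₀ (pow_ne_zero _ hz0)).mp (sub_eq_zero.mp h)
      exact hwv (Fin.ext (hprim.pow_inj v.2 w.2 h2).symm)
    have hpow : ζ ^ N = 1 := by
      rw [hζ, mul_pow, inv_pow, ← pow_mul, ← pow_mul, mul_comm (v : ℕ), mul_comm (w : ℕ), pow_mul,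
        pow_mul, hprim.pow_eq_one]
      simp
    have hg := geom_sum_mul ζ N
    rw [hpow, sub_self] at hg
    rw [(mul_eq_zero.mp hg).resolve_right hne, mul_zero]

/-- The inverse Fourier transform as a unitary. -/
noncomputable def invQFT (N : ℕ) : Matrix.unitaryGroup (Fin N) ℂ :=
  ⟨invQFTMatrix N, invQFTMatrix_mem N⟩

/-- `e^{iHt}` (or `e^{-iHt}` for `inv = true`), multiplexed over the value `t` of the `i`-th time
register: for each of its `m` qubits `k`, the power `2^k` of `e^{± iH}` controlled on that qubit. -/
def muxEvol {D m : ℕ} (b : Fin (D + 1) → ℕ) (d : ℕ) (i : Fin D) (inv : Bool) :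
    Circuit (Fin D → Fin (2 ^ m)) b d :=
  (List.range m).flatMap fun k =>
    List.replicate (2 ^ k) (.evol inv fun w => (w i : ℕ).testBit k)

/-- The circuit with `D` time registers of `m` qubits: prepare the window in each time register with
the unitary `UL` and the initial eigenstate in the system, apply
`V_I⁽⁰⁾(t_D) V_I⁽¹⁾(t_{D-1}) ⋯ V_I⁽ᴰ⁻¹⁾(t_1) V⁽ᴰ⁾` with `V_I(t) = e^{iHt} V e^{-iHt}`, multiplexed over
the time registers and with block-encodings in place of the operators, then apply the inverse
Fourier transform to each time register. -/
noncomputable def squareCircuit {D m : ℕ} (b : Fin (D + 1) → ℕ) (d : ℕ)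
    (UL : Matrix.unitaryGroup (Fin (2 ^ m)) ℂ) : Circuit (Fin D → Fin (2 ^ m)) b d :=
  [.free (onTime b d UL), .prep false, .block (Fin.last D) false] ++
    ((List.finRange D).flatMap fun i =>
      muxEvol b d i true ++ [.block (Fin.rev i).castSucc false] ++ muxEvol b d i false) ++
    [.free (onTime b d (invQFT (2 ^ m)))]

section square

variable {D d m : ℕ} [NeZero d] {b : Fin (D + 1) → ℕ} [∀ j, NeZero (b j)] {a : Fin (D + 1) → ℝ}

/-- Probability that the circuit, with all registers started in `0`, yields the frequencies `ω` in
the time registers together with success (outcome `0`) of all block-encodings. -/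
noncomputable def squareProb (P : Problem D d b a) (UL : Matrix.unitaryGroup (Fin (2 ^ m)) ℂ)
    (ω : Fin D → Fin (2 ^ m)) : ℝ :=
  ∑ s, outcomeProb P (fun _ => 0) (squareCircuit b d UL) (ω, fun _ => 0, s)

/-- The real frequencies `2πω/N` for the outcome `ω` of the time registers, with `N = 2^m`. -/
noncomputable def gridFreq (ω : Fin D → Fin (2 ^ m)) : Fin D → ℝ :=
  fun i => 2 * Real.pi * (ω i : ℕ) / (2 ^ m : ℕ)

open Classical in
/-- Direct sampling: `Ω²` times the fraction of the `M` runs that gave `ω` with success of all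
block-encodings. -/
noncomputable def sampleEstimate (Ω : ℝ) {M : ℕ} (x : Fin M → Reg (Fin D → Fin (2 ^ m)) b d)
    (ω : Fin D → Fin (2 ^ m)) : ℝ :=
  Ω ^ 2 * ((Finset.univ.filter fun t => (x t).1 = ω ∧ (x t).2.1 = fun _ => 0).card : ℝ) / M

end square

end GQPE

namespace GQPE

/-! ### Fiberwise linear maps -/

section fiber

variable {ι κ F : Type*} [Fintype F]

/-! Expanded in energy eigenvectors, controlled evolution multiplies amplitudes by phases. Powers
`2^k` of `e^{± iH}` controlled on the bits of `t` multiply up to `e^{± iHt}`, and conjugating a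
block-encoding with them gives the matrix elements of `V⁽ʲ⁾`, divided by `a j`, times `e^{it(λ_n -
λ_n')}`. Each block-encoding occurs once and has its own ancilla, so the branch with all ancillas in
`0` evolves by these matrices alone. Its final amplitude is a sum over paths of eigenstates, divided
by `Ω`. Along a path each time register carries an independent sum over `t`; with the coefficients
`α` and the inverse Fourier transform this sum is the window at the energy difference minus the
measured frequency. Hence the response is `Ω²` times an outcome probability
(`output_responseCircuit`, `R2_eq`). Extra phases in the preparation shift the grid, so any real
point can be made the outcome `0`.

Windows of resolution `η` come from powers of the Dirichlet kernel (`exists_hasResolution`). Away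
from `2πℤ` a kernel of length about `9/η` is smaller than its peak by a factor `e`, so about
`log(1/ξ)` factors push the tail below `ξ`.

At one point the probability is read off by amplitude estimation. The Grover operator rotates the
plane of the good and the bad part of the output by `2θ`, where `sin² θ` is the probability of
success. Phase estimation of this rotation uses the same kind of window, now with resolution `ε/Ω²`,
and so takes `O(Ω²/ε)` runs of the circuit (`amplitude_failure_le`).

On the whole grid the empirical frequencies are controlled by Chebyshev's inequality. The outcomes
are disjoint, so their variances sum to at most `1`, and the union over all grid points costs
nothing (`eventProb_frequency_failure_le`). -/

/-- The linear map acting on each fiber `{k} × F` of `ι ≃ κ × F` by the matrix `U k`. -/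
def fiberAct (e : ι ≃ κ × F) (U : κ → Matrix F F ℂ) (ψ : ι → ℂ) : ι → ℂ :=
  fun x => ∑ f, U (e x).1 (e x).2 f * ψ (e.symm ((e x).1, f))

theorem fiberAct_fiberAct (e : ι ≃ κ × F) (U U' : κ → Matrix F F ℂ) (ψ : ι → ℂ) :
    fiberAct e U (fiberAct e U' ψ) = fiberAct e (fun k => U k * U' k) ψ := by
  funext x
  simp only [fiberAct, Equiv.apply_symm_apply, Finset.mul_sum, Matrix.mul_apply, Finset.sum_mul]
  rw [Finset.sum_comm]
  simp only [mul_assoc]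

theorem fiberAct_one [DecidableEq F] (e : ι ≃ κ × F) (ψ : ι → ℂ) :
    fiberAct e (fun _ => 1) ψ = ψ := by
  funext x
  simp [fiberAct, Matrix.one_apply]

theorem dotProduct_fiberAct [Fintype ι] [Fintype κ] (e : ι ≃ κ × F) (U : κ → Matrix F F ℂ)
    (χ ψ : ι → ℂ) :
    star χ ⬝ᵥ fiberAct e U ψ = star (fiberAct e (fun k => (U k)ᴴ) χ) ⬝ᵥ ψ := by
  simp only [dotProduct]
  rw [← e.symm.sum_comp, ← e.symm.sum_comp (fun x => star (fiberAct e (fun k => (U k)ᴴ) χ) x * ψ x)]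
  simp only [Fintype.sum_prod_type]
  refine Finset.sum_congr rfl fun k _ => ?_
  simp only [fiberAct, Equiv.apply_symm_apply, Pi.star_apply, star_sum, star_mul',
    Matrix.conjTranspose_apply, star_star, Finset.mul_sum, Finset.sum_mul]
  rw [Finset.sum_comm]
  refine Finset.sum_congr rfl fun i _ => Finset.sum_congr rfl fun j _ => by ring

end fiber

/-! ### Gates and circuits as invertible, norm-preserving linear maps -/

section circuits

variable {W : Type} [Fintype W] [DecidableEq W] {D d : ℕ} {b : Fin (D + 1) → ℕ}

/-- The inverse gate. -/
def Gate.inv : Gate W b d → Gate W b d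
  | .free U => .free U⁻¹
  | .evol i c => .evol (!i) c
  | .block j i => .block j (!i)
  | .prep i => .prep (!i)

theorem Gate.inv_inv (g : Gate W b d) : g.inv.inv = g := by
  cases g <;> simp [Gate.inv]

/-- The inverse circuit. -/
def invCircuit (C : Circuit W b d) : Circuit W b d := (C.map Gate.inv).reverse

theorem invCircuit_cons (g : Gate W b d) (C : Circuit W b d) :
    invCircuit (g :: C) = invCircuit C ++ [g.inv] := by
  simp [invCircuit]

theorem invCircuit_invCircuit (C : Circuit W b d) : invCircuit (invCircuit C) = C := by
  simp [invCircuit, Function.comp_def, Gate.inv_inv]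

variable [NeZero d] [∀ j, NeZero (b j)] {a : Fin (D + 1) → ℝ}

theorem Problem.conjTranspose_H (P : Problem D d b a) : P.Hᴴ = P.H := by
  ext s s'
  simp only [Problem.H, Matrix.conjTranspose_apply, Matrix.of_apply, star_sum, star_mul',
    Complex.star_def, Complex.conj_ofReal, Complex.conj_conj]
  exact Finset.sum_congr rfl fun n _ => by ring

/-- The time evolution `e^{± iH}`. -/
noncomputable def Problem.evolMatrix (P : Problem D d b a) (inv : Bool) :
    Matrix (Fin d) (Fin d) ℂ :=
  NormedSpace.exp ((if inv then -Complex.I else Complex.I) • P.H)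

theorem Problem.conjTranspose_evolMatrix (P : Problem D d b a) (inv : Bool) :
    (P.evolMatrix inv)ᴴ = P.evolMatrix (!inv) := by
  rw [Problem.evolMatrix, ← Matrix.exp_conjTranspose, Matrix.conjTranspose_smul,
    P.conjTranspose_H, Problem.evolMatrix]
  cases inv <;> simp

theorem Problem.evolMatrix_mul (P : Problem D d b a) (inv : Bool) :
    P.evolMatrix (!inv) * P.evolMatrix inv = 1 := by
  have h : (if (!inv) = true then -Complex.I else Complex.I) • P.H
      = -((if inv = true then -Complex.I else Complex.I) • P.H) := by
    cases inv <;> simp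
  have hu := Matrix.isUnit_exp ((if inv = true then -Complex.I else Complex.I) • P.H)
  rw [Problem.evolMatrix, Problem.evolMatrix, h, Matrix.exp_neg,
    Matrix.nonsing_inv_mul _ ((Matrix.isUnit_iff_isUnit_det _).mp hu)]

/-- A gate as a linear map on state vectors acts fiberwise. -/
theorem Gate.exists_fiberAct (P : Problem D d b a) (g : Gate W b d) :
    ∃ (κ F : Type) (_ : Fintype κ) (_ : Fintype F) (_ : DecidableEq F)
      (e : Reg W b d ≃ κ × F) (U : κ → Matrix F F ℂ),
      (∀ k, (U k)ᴴ * U k = 1) ∧ (∀ ψ, g.apply P ψ = fiberAct e U ψ) ∧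
      ∀ ψ, g.inv.apply P ψ = fiberAct e (fun k => (U k)ᴴ) ψ := by
  cases g with
  | free U =>
    refine ⟨Unit, Reg W b d, inferInstance, inferInstance, inferInstance,
      (Equiv.uniqueProd _ _).symm, fun _ => U.1, fun _ => ?_, fun ψ => ?_, fun ψ => ?_⟩
    · exact Matrix.mem_unitaryGroup_iff'.mp U.2
    · funext x
      simp [Gate.apply, fiberAct, Matrix.mulVec, dotProduct]
    · funext x
      simp [Gate.apply, Gate.inv, fiberAct, Matrix.mulVec, dotProduct]
  -- The control reads only the work register, which is part of the fiber label, so the matrix is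
  -- constant on each fiber.
  | evol i c =>
    refine ⟨W × ((j : Fin (D + 1)) → Fin (b j)), Fin d, inferInstance, inferInstance, inferInstance,
      (Equiv.prodAssoc _ _ _).symm, fun k => if c k.1 then P.evolMatrix i else 1,
      fun k => ?_, fun ψ => ?_, fun ψ => ?_⟩
    · dsimp only
      split_ifs
      · rw [P.conjTranspose_evolMatrix, P.evolMatrix_mul]
      · simp
    · funext x
      by_cases h : c x.1 <;>
      simp [Gate.apply, fiberAct, Problem.evolMatrix, h, Matrix.one_apply]
    · funext x
      by_cases h : c x.1
      · simp only [Gate.apply, Gate.inv, fiberAct, h, if_true, Equiv.symm_symm,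
          Equiv.prodAssoc_symm_apply, P.conjTranspose_evolMatrix]
        rfl
      · simp [Gate.apply, Gate.inv, fiberAct, h, Matrix.one_apply]
  | block j i =>
    -- The fiber consists of ancilla `j` and the system; all other ancillas join the label.
    let e : Reg W b d ≃ (W × ((k : {k // k ≠ j}) → Fin (b k))) × (Fin (b j) × Fin d) :=
      { toFun := fun x => ((x.1, fun k => x.2.1 k), (x.2.1 j, x.2.2))
        invFun := fun y => (y.1.1, (Equiv.piSplitAt j fun k => Fin (b k)).symm (y.2.1, y.1.2), y.2.2)
        left_inv := fun x => by
          refine Prod.ext rfl (Prod.ext ?_ rfl)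
          exact (Equiv.piSplitAt j fun k => Fin (b k)).symm_apply_apply x.2.1
        right_inv := fun y => by
          have := (Equiv.piSplitAt j fun k => Fin (b k)).apply_symm_apply (y.2.1, y.1.2)
          rw [Prod.ext_iff] at this
          exact Prod.ext (Prod.ext rfl this.2) (Prod.ext this.1 rfl) }
    have he : ∀ (x : Reg W b d) f, e.symm ((e x).1, f) = (x.1, Function.update x.2.1 j f.1, f.2) := by
      intro x f
      refine Prod.ext rfl (Prod.ext ?_ rfl)
      funext k
      by_cases hk : k = j
      · subst hk; simp [e]
      · simp [e, hk]
    refine ⟨_, _, inferInstance, inferInstance, inferInstance, e,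
      fun _ => if i then (P.UV j).1ᴴ else (P.UV j).1, fun k => ?_, fun ψ => ?_, fun ψ => ?_⟩
    · cases i
      · exact Matrix.mem_unitaryGroup_iff'.mp (P.UV j).2
      · simp only [if_true, Matrix.conjTranspose_conjTranspose]
        exact Matrix.mem_unitaryGroup_iff.mp (P.UV j).2
    · funext x
      simp only [Gate.apply, fiberAct, he]
      rfl
    · funext x
      simp only [Gate.apply, Gate.inv, fiberAct, he]
      cases i
      · rfl
      · simp [e]
  | prep i =>
    refine ⟨W × ((j : Fin (D + 1)) → Fin (b j)), Fin d, inferInstance, inferInstance, inferInstance,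
      (Equiv.prodAssoc _ _ _).symm, fun k => if i then P.Uprep.1ᴴ else P.Uprep.1,
      fun k => ?_, fun ψ => ?_, fun ψ => ?_⟩
    · cases i
      · exact Matrix.mem_unitaryGroup_iff'.mp P.Uprep.2
      · simp only [if_true, Matrix.conjTranspose_conjTranspose]
        exact Matrix.mem_unitaryGroup_iff.mp P.Uprep.2
    · funext x
      simp [Gate.apply, fiberAct]
    · funext x
      cases i <;> simp [Gate.apply, Gate.inv, fiberAct]

theorem Gate.inv_apply_apply (P : Problem D d b a) (g : Gate W b d) (ψ : Reg W b d → ℂ) :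
    g.inv.apply P (g.apply P ψ) = ψ := by
  obtain ⟨κ, F, _, _, _, e, U, hU, h1, h2⟩ := g.exists_fiberAct P
  rw [h1, h2, fiberAct_fiberAct]
  simp only [hU]
  exact fiberAct_one e ψ

theorem Gate.dotProduct_apply (P : Problem D d b a) (g : Gate W b d) (χ ψ : Reg W b d → ℂ) :
    star χ ⬝ᵥ g.apply P ψ = star (g.inv.apply P χ) ⬝ᵥ ψ := by
  obtain ⟨κ, F, _, _, _, e, U, hU, h1, h2⟩ := g.exists_fiberAct P
  rw [h1, h2, dotProduct_fiberAct]

theorem Gate.apply_linear (P : Problem D d b a) (g : Gate W b d) (r s : ℂ) (χ ψ : Reg W b d → ℂ) :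
    g.apply P (r • χ + s • ψ) = r • g.apply P χ + s • g.apply P ψ := by
  obtain ⟨κ, F, _, _, _, e, U, hU, h1, h2⟩ := g.exists_fiberAct P
  rw [h1, h1, h1]
  funext x
  simp only [fiberAct, Pi.add_apply, Pi.smul_apply, smul_eq_mul, Finset.mul_sum,
    ← Finset.sum_add_distrib]
  exact Finset.sum_congr rfl fun f _ => by ring

/-- The state after the circuit, for an arbitrary initial state. -/
noncomputable def run (P : Problem D d b a) (C : Circuit W b d) (ψ : Reg W b d → ℂ) :
    Reg W b d → ℂ :=
  C.foldl (fun ψ g => g.apply P ψ) ψ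

@[simp] theorem run_nil (P : Problem D d b a) (ψ : Reg W b d → ℂ) : run P [] ψ = ψ := rfl

@[simp] theorem run_cons (P : Problem D d b a) (g : Gate W b d) (C : Circuit W b d)
    (ψ : Reg W b d → ℂ) : run P (g :: C) ψ = run P C (g.apply P ψ) := rfl

@[simp] theorem run_append (P : Problem D d b a) (C C' : Circuit W b d) (ψ : Reg W b d → ℂ) :
    run P (C ++ C') ψ = run P C' (run P C ψ) := by
  simp [run, List.foldl_append]

theorem run_invCircuit_run (P : Problem D d b a) (C : Circuit W b d) (ψ : Reg W b d → ℂ) :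
    run P (invCircuit C) (run P C ψ) = ψ := by
  induction C generalizing ψ with
  | nil => rfl
  | cons g C ih => rw [invCircuit_cons, run_append, run_cons, run_cons, ih, run_nil,
      Gate.inv_apply_apply]

theorem run_run_invCircuit (P : Problem D d b a) (C : Circuit W b d) (ψ : Reg W b d → ℂ) :
    run P C (run P (invCircuit C) ψ) = ψ := by
  simpa only [invCircuit_invCircuit] using run_invCircuit_run P (invCircuit C) ψ

/-- Gate by gate the adjoint is the inverse. This gives conservation of probability, and later turns
the overlap with the initial state in the Grover operator into an overlap with the output. -/
theorem dotProduct_run (P : Problem D d b a) (C : Circuit W b d) (χ ψ : Reg W b d → ℂ) :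
    star χ ⬝ᵥ run P C ψ = star (run P (invCircuit C) χ) ⬝ᵥ ψ := by
  induction C generalizing ψ with
  | nil => rfl
  | cons g C ih => rw [run_cons, ih, Gate.dotProduct_apply, invCircuit_cons, run_append, run_cons,
      run_nil]

theorem run_linear (P : Problem D d b a) (C : Circuit W b d) (r s : ℂ) (χ ψ : Reg W b d → ℂ) :
    run P C (r • χ + s • ψ) = r • run P C χ + s • run P C ψ := by
  induction C generalizing χ ψ with
  | nil => rfl
  | cons g C ih => rw [run_cons, Gate.apply_linear, ih, run_cons, run_cons]

theorem dotProduct_star_self_eq_sum {ι : Type*} [Fintype ι] (ψ : ι → ℂ) :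
    star ψ ⬝ᵥ ψ = ((∑ x, ‖ψ x‖ ^ 2 : ℝ) : ℂ) := by
  simp only [dotProduct, Pi.star_apply, Complex.star_def, Complex.conj_mul']
  push_cast
  rfl

theorem sum_norm_sq_run (P : Problem D d b a) (C : Circuit W b d) (ψ : Reg W b d → ℂ) :
    ∑ x, ‖run P C ψ x‖ ^ 2 = ∑ x, ‖ψ x‖ ^ 2 := by
  have h := dotProduct_run P C (run P C ψ) ψ
  rw [run_invCircuit_run, dotProduct_star_self_eq_sum, dotProduct_star_self_eq_sum] at h
  exact_mod_cast h

theorem sum_outcomeProb (P : Problem D d b a) (w0 : W) (C : Circuit W b d) :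
    ∑ x, outcomeProb P w0 C x = 1 := by
  have h := sum_norm_sq_run P C (Pi.single (w0, fun _ => 0, 0) 1)
  have h2 : ∑ x : Reg W b d, ‖(Pi.single (w0, fun _ => 0, 0) 1 : Reg W b d → ℂ) x‖ ^ 2 = 1 := by
    rw [Finset.sum_eq_single (w0, fun _ => 0, 0)]
    · simp
    · intro x _ hx
      simp [Pi.single_eq_of_ne hx]
    · simp
  rw [h2] at h
  exact h

end circuits

/-! ### Independent samples -/

section prob

variable {X : Type} [Fintype X] {T : ℕ}

theorem sum_prod_eq_one (p : Fin T → X → ℝ) (hp : ∀ t, ∑ x, p t x = 1) :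
    ∑ x : Fin T → X, ∏ t, p t (x t) = 1 := by
  classical
  rw [← Fintype.prod_sum]
  simp [hp]

theorem eventProb_add_eventProb_not (p : Fin T → X → ℝ) (hp : ∀ t, ∑ x, p t x = 1)
    (E : (Fin T → X) → Prop) : eventProb p E + eventProb p (fun x => ¬ E x) = 1 := by
  rw [← sum_prod_eq_one p hp, eventProb, eventProb, ← Finset.sum_add_distrib]
  refine Finset.sum_congr rfl fun x _ => ?_
  by_cases h : E x <;> simp [h]

theorem eventProb_of_forall (p : Fin T → X → ℝ) (hp : ∀ t, ∑ x, p t x = 1)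
    (E : (Fin T → X) → Prop) (hE : ∀ x, E x) : eventProb p E = 1 := by
  rw [← sum_prod_eq_one p hp, eventProb]
  exact Finset.sum_congr rfl fun x _ => by simp [hE x]

/-- The sum of independent centered variables has as second moment the sum of their variances. -/
theorem sum_prod_mul_sq_sum (p f : X → ℝ) (hp : ∑ x, p x = 1) (hf : ∑ x, p x * f x = 0) :
    ∑ x : Fin T → X, (∏ t, p (x t)) * (∑ t, f (x t)) ^ 2 = T * ∑ x, p x * f x ^ 2 := by
  classical
  -- By independence a mixed moment factorises over the samples; off the diagonal it contains the
  -- factor `∑ x, p x * f x = 0`.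
  have key : ∀ t t' : Fin T, ∑ x : Fin T → X, (∏ s, p (x s)) * (f (x t) * f (x t'))
      = if t = t' then ∑ x, p x * f x ^ 2 else 0 := by
    intro t t'
    have h1 : ∀ x : Fin T → X, (∏ s, p (x s)) * (f (x t) * f (x t'))
        = ∏ s, p (x s) * ((if s = t then f (x s) else 1) * (if s = t' then f (x s) else 1)) := by
      intro x
      rw [Finset.prod_mul_distrib, Finset.prod_mul_distrib, Finset.prod_ite_eq' _ t,
        Finset.prod_ite_eq' _ t', if_pos (Finset.mem_univ _), if_pos (Finset.mem_univ _)]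
    simp_rw [h1]
    rw [← Fintype.prod_sum (fun s y => p y * ((if s = t then f y else 1) *
      (if s = t' then f y else 1)))]
    split_ifs with h
    · subst h
      rw [Finset.prod_eq_single t]
      · simp [sq]
      · intro s _ hs
        simp [hs, hp]
      · simp
    · refine Finset.prod_eq_zero (Finset.mem_univ t) ?_
      simpa [h] using hf
  have h2 : ∀ x : Fin T → X, (∏ t, p (x t)) * (∑ t, f (x t)) ^ 2
      = ∑ t, ∑ t', (∏ s, p (x s)) * (f (x t) * f (x t')) := by
    intro x
    rw [sq, Finset.sum_mul_sum, Finset.mul_sum]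
    simp only [Finset.mul_sum]
  simp_rw [h2]
  rw [Finset.sum_comm]
  simp_rw [Finset.sum_comm (s := (Finset.univ : Finset (Fin T → X))), key]
  simp

end prob

/-- Every unit vector is the first column of a unitary matrix. -/
theorem exists_unitary_column {N : ℕ} [NeZero N] (α : Fin N → ℂ) (hα : ∑ k, ‖α k‖ ^ 2 = 1) :
    ∃ U : Matrix.unitaryGroup (Fin N) ℂ, ∀ k, U.1 k 0 = α k := by
  -- A family with the single index `0`; its extension to an orthonormal basis indexed by `Fin N`
  -- supplies the other columns.
  have ho : Orthonormal ℂ (Set.domRestrict {(0 : Fin N)}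
      (fun _ => (WithLp.toLp 2 α : EuclideanSpace ℂ (Fin N)))) := by
    refine ⟨fun i => ?_, fun i j hij => absurd (Subsingleton.elim i j) hij⟩
    simp [EuclideanSpace.norm_eq, Set.domRestrict, hα]
  obtain ⟨B, hB⟩ := ho.exists_orthonormalBasis_extension_of_card_eq (by simp)
  refine ⟨⟨Matrix.of fun s n => B n s, ?_⟩, fun k => ?_⟩
  · rw [Matrix.mem_unitaryGroup_iff']
    ext n n'
    have := orthonormal_iff_ite.mp B.orthonormal n n'
    rw [PiLp.inner_apply] at this
    rw [Matrix.mul_apply, Matrix.one_apply, ← this]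
    simp [Matrix.star_apply, mul_comm]
  · simp [hB 0 rfl]

/-! ### Windows -/

theorem sum_norm_sq_mulVec {ι : Type*} [Fintype ι] [DecidableEq ι] {U : Matrix ι ι ℂ}
    (hU : U ∈ Matrix.unitaryGroup ι ℂ) (v : ι → ℂ) :
    ∑ i, ‖(U *ᵥ v) i‖ ^ 2 = ∑ i, ‖v i‖ ^ 2 := by
  have h : star (U *ᵥ v) ⬝ᵥ (U *ᵥ v) = star v ⬝ᵥ v := by
    rw [Matrix.star_mulVec, ← Matrix.dotProduct_mulVec, Matrix.mulVec_mulVec]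
    have := Matrix.mem_unitaryGroup_iff'.mp hU
    rw [Matrix.star_eq_conjTranspose] at this
    rw [this, Matrix.one_mulVec]
  rw [dotProduct_star_self_eq_sum, dotProduct_star_self_eq_sum] at h
  exact_mod_cast h

/-- On the grid the window is a discrete Fourier transform of the coefficients with phases
`e^{itθ}`, so unitarity of that transform yields Parseval's identity. -/
theorem window_sub_grid {N : ℕ} (α : Fin N → ℂ) (θ : ℝ) (k : Fin N) :
    window α (θ - 2 * Real.pi * (k : ℕ) / N) =
      (invQFTMatrix N *ᵥ fun t => α t * Complex.exp (Complex.I * ((t : ℕ) : ℂ) * θ)) k := by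
  simp only [window, Matrix.mulVec, dotProduct, invQFTMatrix, Matrix.of_apply, Finset.mul_sum]
  refine Finset.sum_congr rfl fun t _ => ?_
  have : Complex.exp (Complex.I * ((t : ℕ) : ℂ) * ((θ - 2 * Real.pi * (k : ℕ) / N : ℝ) : ℂ))
      = Complex.exp (-(2 * Real.pi * Complex.I * ((t : ℕ) : ℂ) * ((k : ℕ) : ℂ) / (N : ℂ))) *
        Complex.exp (Complex.I * ((t : ℕ) : ℂ) * θ) := by
    rw [← Complex.exp_add]
    congr 1
    push_cast
    ring
  rw [this]
  ring

/-- Parseval's identity on the frequency grid. -/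
theorem sum_norm_sq_window {N : ℕ} (α : Fin N → ℂ) (θ : ℝ) :
    ∑ k : Fin N, ‖window α (θ - 2 * Real.pi * (k : ℕ) / N)‖ ^ 2 = ∑ k, ‖α k‖ ^ 2 := by
  simp_rw [window_sub_grid]
  rw [sum_norm_sq_mulVec (invQFTMatrix_mem N)]
  refine Finset.sum_congr rfl fun t _ => ?_
  rw [norm_mul]
  have : Complex.I * ((t : ℕ) : ℂ) * (θ : ℂ) = (((t : ℕ) * θ : ℝ) : ℂ) * Complex.I := by
    push_cast
    ring
  rw [this, Complex.norm_exp_ofReal_mul_I, mul_one]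

open Classical in
/-- The probability that phase estimation errs by more than `η`. -/
noncomputable def windowTail {N : ℕ} (α : Fin N → ℂ) (η θ : ℝ) : ℝ :=
  ∑ k : Fin N, if ∃ z : ℤ, |θ - 2 * Real.pi * (k : ℕ) / N - 2 * Real.pi * z| ≤ η then 0 else
    ‖window α (θ - 2 * Real.pi * (k : ℕ) / N)‖ ^ 2

/-- By Parseval the total weight on the grid is `1`, so a bound on the near weight from below is one
on the far weight from above. -/
theorem hasResolution_iff {N : ℕ} {α : Fin N → ℂ} (hα : ∑ k, ‖α k‖ ^ 2 = 1) (η ξ : ℝ) :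
    HasResolution α η ξ ↔ ∀ θ, windowTail α η θ ≤ ξ := by
  refine forall_congr' fun θ => ?_
  rw [← hα, ← sum_norm_sq_window α θ, windowTail, sub_le_comm, ← Finset.sum_sub_distrib]
  refine iff_of_eq (congrArg (· ≤ ξ) (Finset.sum_congr rfl fun k _ => ?_))
  split_ifs <;> simp

/-- Jordan's inequality, in the form that bounds the denominator of a geometric sum of phases. -/
theorem abs_le_pi_mul_abs_sin_half {y : ℝ} (hy : |y| ≤ Real.pi) :
    |y| ≤ Real.pi * |Real.sin (y / 2)| := by
  have h := Real.mul_abs_le_abs_sin (x := y / 2) (by rw [abs_div, abs_two]; linarith)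
  have hp := Real.pi_pos
  rw [abs_div, abs_two] at h
  calc |y| = Real.pi * (2 / Real.pi * (|y| / 2)) := by field_simp
    _ ≤ _ := mul_le_mul_of_nonneg_left h hp.le

theorem norm_exp_mul_I_sub_one (x : ℝ) :
    ‖Complex.exp (Complex.I * x) - 1‖ = 2 * |Real.sin (x / 2)| := by
  rw [Complex.norm_exp_I_mul_ofReal_sub_one]
  simp

/-- Away from the multiples of `2π` the Dirichlet kernel is bounded. -/
theorem norm_geom_sum_exp_le {η x : ℝ} (hη : 0 < η)
    (hx : ¬ ∃ z : ℤ, |x - 2 * Real.pi * z| ≤ η) (n : ℕ) :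
    ‖∑ t ∈ Finset.range n, Complex.exp (Complex.I * x) ^ t‖ ≤ Real.pi / η := by
  have hp := Real.pi_pos
  -- Reduction modulo `2π` to a representative `y` with `η < |y| ≤ π`. The geometric sum times `2
  -- |sin (y / 2)|` is then at most `2`, and `|y| ≤ π |sin (y / 2)|`.
  set z : ℤ := round (x / (2 * Real.pi)) with hz
  set y : ℝ := x - 2 * Real.pi * z with hy
  have hyη : η < |y| := not_le.mp fun h => hx ⟨z, h⟩
  have hyπ : |y| ≤ Real.pi := by
    have h := abs_sub_round (x / (2 * Real.pi))
    have h2 : y = 2 * Real.pi * (x / (2 * Real.pi) - z) := by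
      rw [hy]; field_simp
    rw [h2, abs_mul, abs_of_pos (by positivity)]
    nlinarith
  have he : Complex.exp (Complex.I * x) = Complex.exp (Complex.I * y) := by
    rw [Complex.exp_eq_exp_iff_exists_int]
    refine ⟨z, ?_⟩
    rw [hy]
    push_cast
    ring
  have hs := abs_le_pi_mul_abs_sin_half hyπ
  have hs' : 0 < |Real.sin (y / 2)| := by
    by_contra h
    have : |Real.sin (y / 2)| = 0 := le_antisymm (not_lt.mp h) (abs_nonneg _)
    rw [this, mul_zero] at hs
    linarith
  have h1 := geom_sum_mul (Complex.exp (Complex.I * y)) n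
  have h2 : ‖Complex.exp (Complex.I * y) ^ n - 1‖ ≤ 2 := by
    refine (norm_sub_le _ _).trans ?_
    rw [norm_pow, mul_comm, Complex.norm_exp_ofReal_mul_I]
    norm_num
  rw [← h1, norm_mul, norm_exp_mul_I_sub_one] at h2
  rw [he, le_div_iff₀ hη]
  have h3 : ‖∑ t ∈ Finset.range n, Complex.exp (Complex.I * y) ^ t‖ * |Real.sin (y / 2)| ≤ 1 := by
    linarith
  have h4 := norm_nonneg (∑ t ∈ Finset.range n, Complex.exp (Complex.I * y) ^ t)
  nlinarith

open Polynomial in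
/-- Windows with exponentially small tails: powers of the Dirichlet kernel. -/
theorem exists_hasResolution {η ξ : ℝ} (hη : 0 < η) (hη1 : η < 1) (hξ : 0 < ξ) (hξ1 : ξ ≤ 1) :
    ∃ (m : ℕ) (α : Fin (2 ^ m) → ℂ), ∑ k, ‖α k‖ ^ 2 = 1 ∧ HasResolution α η ξ ∧
      (2 ^ m : ℝ) ≤ 40 * (Real.log (1 / ξ) + 1) / η := by
  have hp := Real.pi_pos
  have hL : 0 ≤ Real.log (1 / ξ) := Real.log_nonneg (by rw [le_div_iff₀ hξ]; linarith)
  -- The length of the kernel: `9` exceeds `e π`, so off-peak each factor, at most `π / η`, is below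
  -- `n / e`.
  obtain ⟨n, hn9, hn10⟩ : ∃ n : ℕ, 9 / η ≤ n ∧ (n : ℝ) ≤ 10 / η := by
    refine ⟨⌈9 / η⌉₊, Nat.le_ceil _, (Nat.ceil_lt_add_one (by positivity)).le.trans ?_⟩
    rw [div_add' _ _ _ hη.ne', div_le_div_iff_of_pos_right hη]
    linarith
  -- The number of kernel factors that produce the decay; one more factor is reserved for Parseval.
  obtain ⟨q, hq, hq'⟩ : ∃ q : ℕ, Real.log (1 / ξ) ≤ q ∧ (q : ℝ) ≤ Real.log (1 / ξ) + 1 :=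
    ⟨⌈Real.log (1 / ξ)⌉₊, Nat.le_ceil _, (Nat.ceil_lt_add_one hL).le⟩
  have hnR : (0 : ℝ) < n := lt_of_lt_of_le (by positivity) hn9
  have hn : 0 < n := by exact_mod_cast hnR
  have hK : 0 < (q + 1) * n := by positivity
  -- The `(q + 1)`-st power of the kernel has fewer than `(q + 1) * n + 1` coefficients; rounding up
  -- to a power of two at most doubles their number.
  obtain ⟨m, hm1, hm2⟩ : ∃ m : ℕ, (q + 1) * n ≤ 2 ^ m ∧ 2 ^ m ≤ 2 * ((q + 1) * n) := by
    refine ⟨Nat.clog 2 ((q + 1) * n), Nat.le_pow_clog (by norm_num) _, ?_⟩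
    rcases Nat.lt_or_ge 1 ((q + 1) * n) with h | h
    · have h1 := Nat.pow_pred_clog_lt_self (b := 2) (by norm_num) h
      have h2 := Nat.clog_pos (b := 2) (by norm_num) h
      calc 2 ^ Nat.clog 2 ((q + 1) * n) = 2 * 2 ^ (Nat.clog 2 ((q + 1) * n)).pred := by
            rw [← pow_succ', Nat.pred_eq_sub_one, Nat.sub_add_cancel h2]
        _ ≤ _ := by omega
    · rw [Nat.clog_of_right_le_one h]
      omega
  set N := 2 ^ m with hN
  have hnN : n ≤ N := le_trans (Nat.le_mul_of_pos_left n (Nat.succ_pos q)) hm1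
  -- the coefficients of a power of the Dirichlet kernel
  set G : ℝ[X] := ∑ t ∈ Finset.range n, X ^ t with hG
  set c : ℕ → ℝ := fun k => (G ^ (q + 1)).coeff k with hc
  have hdeg : (G ^ (q + 1)).natDegree < (q + 1) * n := by
    have h1 : G.natDegree ≤ n - 1 := by
      refine natDegree_sum_le_of_forall_le _ _ fun t ht => ?_
      rw [natDegree_X_pow]
      have := Finset.mem_range.mp ht
      omega
    calc (G ^ (q + 1)).natDegree ≤ (q + 1) * G.natDegree := natDegree_pow_le
      _ ≤ (q + 1) * (n - 1) := Nat.mul_le_mul_left _ h1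
      _ < (q + 1) * n := Nat.mul_lt_mul_of_pos_left (by omega) (by omega)
  have hcz : ∀ k, (q + 1) * n ≤ k → c k = 0 := fun k hk =>
    coeff_eq_zero_of_natDegree_lt (lt_of_lt_of_le hdeg hk)
  have hsum : ∑ k ∈ Finset.range ((q + 1) * n), c k = (n : ℝ) ^ (q + 1) := by
    have h := eval_eq_sum_range' hdeg (1 : ℝ)
    simp only [one_pow, mul_one] at h
    rw [← h, eval_pow, hG, eval_finsetSum]
    simp
  set S : ℝ := ∑ k ∈ Finset.range ((q + 1) * n), c k ^ 2 with hS
  -- Cauchy–Schwarz: the coefficients sum to the peak value `n ^ (q + 1)`, which bounds their square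
  -- sum, the normalisation `S`, from below.
  have hCS : ((n : ℝ) ^ (q + 1)) ^ 2 ≤ ((q + 1) * n) * S := by
    rw [← hsum]
    refine sq_sum_le_card_mul_sum_sq.trans (le_of_eq ?_)
    rw [Finset.card_range]
    push_cast
    rfl
  have hSpos : 0 < S := by
    have h : 0 < ((q + 1) * n) * S := lt_of_lt_of_le (by positivity) hCS
    exact pos_of_mul_pos_right h (by positivity)
  have hSN : ∑ k : Fin N, c k ^ 2 = S := by
    rw [Fin.sum_univ_eq_sum_range (fun k => c k ^ 2) N, hS]
    refine (Finset.sum_subset (Finset.range_mono hm1) fun k _ hk => ?_).symm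
    rw [hcz k (by simpa using hk)]
    simp
  set α : Fin N → ℂ := fun k => ((c k / Real.sqrt S : ℝ) : ℂ) with hα
  have hα1 : ∑ k, ‖α k‖ ^ 2 = 1 := by
    have : ∀ k : Fin N, ‖α k‖ ^ 2 = c k ^ 2 / S := by
      intro k
      rw [hα, Complex.norm_real, Real.norm_eq_abs, sq_abs, div_pow, Real.sq_sqrt hSpos.le]
    simp_rw [this]
    rw [← Finset.sum_div, hSN, div_self hSpos.ne']
  -- One unnormalised Dirichlet factor. Its total weight over the grid is `n` by Parseval, so
  -- summing the tail costs a factor `n` and not `N`.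
  set β : Fin N → ℂ := fun k => if (k : ℕ) < n then 1 else 0 with hβ
  have hβn : ∑ k, ‖β k‖ ^ 2 = n := by
    have : ∀ k : Fin N, ‖β k‖ ^ 2 = if (k : ℕ) < n then 1 else 0 := by
      intro k
      rw [hβ]
      dsimp only
      split_ifs <;> simp
    simp_rw [this]
    rw [Fin.sum_univ_eq_sum_range (fun k => if k < n then (1 : ℝ) else 0) N,
      ← Finset.sum_subset (Finset.range_mono hnN)]
    · rw [Finset.sum_congr rfl (g := fun _ => (1 : ℝ))]
      · simp
      · intro k hk
        simp [Finset.mem_range.mp hk]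
    · intro k _ hk
      simp only [Finset.mem_range] at hk
      simp [hk]
  have hexp : ∀ (x : ℝ) (k : ℕ), Complex.exp (Complex.I * (k : ℂ) * x)
      = Complex.exp (Complex.I * x) ^ k := by
    intro x k
    rw [← Complex.exp_nat_mul]
    congr 1
    ring
  have hwβ : ∀ x, window β x = (1 / Real.sqrt N : ℝ) *
      ∑ t ∈ Finset.range n, Complex.exp (Complex.I * x) ^ t := by
    intro x
    rw [window]
    congr 1
    simp_rw [hexp, hβ]
    rw [Fin.sum_univ_eq_sum_range
      (fun k => (if k < n then (1 : ℂ) else 0) * Complex.exp (Complex.I * x) ^ k) N]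
    symm
    refine Finset.sum_subset_zero_on_sdiff (Finset.range_mono hnN) ?_ ?_
    · intro k hk
      simp only [Finset.mem_sdiff, Finset.mem_range] at hk
      simp [hk.2]
    · intro k hk
      simp [Finset.mem_range.mp hk]
  have hwα : ∀ x, window α x = (1 / Real.sqrt S : ℝ) *
      (∑ t ∈ Finset.range n, Complex.exp (Complex.I * x) ^ t) ^ q * window β x := by
    intro x
    set u := Complex.exp (Complex.I * x) with hu
    have h1 : ∑ k : Fin N, (c k : ℂ) * u ^ (k : ℕ) = (∑ t ∈ Finset.range n, u ^ t) ^ (q + 1) := by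
      have h2 : ((G ^ (q + 1)).map Complex.ofRealHom).eval u
          = (∑ t ∈ Finset.range n, u ^ t) ^ (q + 1) := by
        rw [hG]
        simp [eval_finsetSum, Polynomial.map_sum]
      rw [← h2, eval_eq_sum_range' (n := N)]
      · rw [Fin.sum_univ_eq_sum_range (fun k => (c k : ℂ) * u ^ k) N]
        simp only [hc, coeff_map, Complex.ofRealHom_eq_coe]
      · exact lt_of_le_of_lt natDegree_map_le (lt_of_lt_of_le hdeg hm1)
    rw [hwβ, window]
    simp_rw [hexp, ← hu]
    have h3 : ∑ k : Fin N, α k * u ^ (k : ℕ)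
        = (1 / Real.sqrt S : ℝ) * ∑ k : Fin N, (c k : ℂ) * u ^ (k : ℕ) := by
      rw [Finset.mul_sum]
      refine Finset.sum_congr rfl fun k _ => ?_
      rw [hα]
      push_cast
      ring
    rw [h3, h1]
    ring
  refine ⟨m, α, hα1, (hasResolution_iff hα1 η ξ).mpr fun θ => ?_, ?_⟩
  · have hB : (0 : ℝ) ≤ 1 / S * ((Real.pi / η) ^ q) ^ 2 := by positivity
    have h1 : windowTail α η θ ≤ 1 / S * ((Real.pi / η) ^ q) ^ 2 * n := by
      rw [← hβn, ← sum_norm_sq_window β θ, Finset.mul_sum]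
      refine Finset.sum_le_sum fun k _ => ?_
      split_ifs with h
      · positivity
      · rw [hwα, norm_mul, norm_mul, norm_pow, Complex.norm_real, Real.norm_eq_abs, mul_pow,
          mul_pow, sq_abs, div_pow, one_pow, Real.sq_sqrt hSpos.le]
        gcongr
        exact norm_geom_sum_exp_le hη h n
    refine h1.trans ?_
    -- compare with the exponential
    have h2 : Real.pi / η / n ≤ Real.exp (-1) := by
      have h3 : Real.exp 1 * Real.pi ≤ 9 := by
        have h4 := Real.exp_one_lt_d9
        have h5 := Real.pi_lt_d2
        nlinarith
      rw [Real.exp_neg, div_le_iff₀ hnR, ← div_eq_inv_mul, le_div_iff₀ (Real.exp_pos 1),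
        div_mul_eq_mul_div, mul_comm Real.pi]
      exact le_trans (by gcongr) hn9
    -- The lower bound for `S` makes every kernel value relative to its peak `n`, at the price of
    -- the factor `q + 1`.
    have h3 : 1 / S * ((Real.pi / η) ^ q) ^ 2 * n ≤ (q + 1) * ((Real.pi / η / n) ^ q) ^ 2 := by
      rw [div_pow _ (n : ℝ), div_pow _ ((n : ℝ) ^ q), mul_div_assoc', div_mul_eq_mul_div,
        div_mul_eq_mul_div, div_le_div_iff₀ hSpos (by positivity), one_mul]
      have h5 := mul_le_mul_of_nonneg_left hCS (by positivity : 0 ≤ ((Real.pi / η) ^ q) ^ 2)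
      have h6 : ((n : ℝ) ^ (q + 1)) ^ 2 = n * (n * (n ^ q) ^ 2) := by ring
      rw [h6] at h5
      have h7 : n * (((Real.pi / η) ^ q) ^ 2 * n * (n ^ q) ^ 2)
          ≤ n * ((q + 1) * ((Real.pi / η) ^ q) ^ 2 * S) := by linarith
      exact le_of_mul_le_mul_left h7 hnR
    refine h3.trans ?_
    have h4 : (Real.pi / η / n) ^ q ≤ Real.exp (-q) := by
      calc (Real.pi / η / n) ^ q ≤ Real.exp (-1) ^ q := by gcongr
        _ = Real.exp (-q) := by rw [← Real.exp_nat_mul]; simp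
    have h5 : Real.exp (-q) ≤ ξ := by
      rw [← Real.exp_log hξ]
      refine Real.exp_le_exp.mpr ?_
      rw [one_div, Real.log_inv] at hq
      linarith
    -- Squaring the amplitude leaves `exp (-q)` twice: one copy absorbs `q + 1`, the other is at
    -- most `ξ`.
    have h6 : (q + 1 : ℝ) * Real.exp (-q) ≤ 1 := by
      rw [Real.exp_neg, ← div_eq_mul_inv, div_le_one (Real.exp_pos _)]
      exact Real.add_one_le_exp _
    calc (q + 1) * ((Real.pi / η / n) ^ q) ^ 2
        ≤ (q + 1) * (Real.exp (-q) * Real.exp (-q)) := by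
          rw [sq]; gcongr
      _ = ((q + 1) * Real.exp (-q)) * Real.exp (-q) := by ring
      _ ≤ 1 * ξ := by gcongr
      _ = ξ := one_mul ξ
  · have h1 : ((2 ^ m : ℕ) : ℝ) ≤ 2 * ((q + 1) * n) := by exact_mod_cast hm2
    push_cast at h1
    refine h1.trans ?_
    calc 2 * ((q + 1) * n) ≤ 2 * ((Real.log (1 / ξ) + 1 + 1) * (10 / η)) := by gcongr
      _ = 20 * (Real.log (1 / ξ) + 2) / η := by ring
      _ ≤ 40 * (Real.log (1 / ξ) + 1) / η := by gcongr ?_ / η; linarith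

/-! ### Circuits in the energy eigenbasis -/

section eigenbasis

variable {W : Type} [Fintype W] [DecidableEq W] {D d : ℕ} [NeZero d] {b : Fin (D + 1) → ℕ}
  [∀ j, NeZero (b j)] {a : Fin (D + 1) → ℝ}

theorem Problem.sum_ket_mul_star (P : Problem D d b a) (s s' : Fin d) :
    ∑ n, P.ket n s * star (P.ket n s') = if s = s' then 1 else 0 := by
  have h := P.ket.sum_inner_mul_inner (EuclideanSpace.single s (1 : ℂ))
    (EuclideanSpace.single s' (1 : ℂ))
  simp only [EuclideanSpace.inner_single_left, EuclideanSpace.inner_single_right] at h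
  simpa [Pi.single_apply, eq_comm] using h

/-- The matrix `B` of eigenvectors is unitary and diagonalises `H`; the exponential commutes with
the conjugation. -/
theorem Problem.evolMatrix_mulVec_ket (P : Problem D d b a) (inv : Bool) (n s : Fin d) :
    ∑ s', P.evolMatrix inv s s' * P.ket n s' =
      Complex.exp ((if inv then -Complex.I else Complex.I) * P.lam n) * P.ket n s := by
  set z : ℂ := if inv then -Complex.I else Complex.I with hz
  set B : Matrix (Fin d) (Fin d) ℂ := Matrix.of fun s n => P.ket n s with hB
  have h1 : B * Bᴴ = 1 := by
    ext s s'
    simp [hB, Matrix.mul_apply, Matrix.one_apply, ← P.sum_ket_mul_star]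
  have h2 : B⁻¹ = Bᴴ := Matrix.inv_eq_right_inv h1
  have hU : IsUnit B := IsUnit.of_mul_eq_one _ h1
  have h3 : z • P.H = B * Matrix.diagonal (fun n => z * P.lam n) * B⁻¹ := by
    rw [h2]
    ext s s'
    rw [Matrix.mul_apply]
    simp only [Matrix.mul_diagonal, Matrix.smul_apply, Problem.H, Matrix.of_apply, hB,
      Matrix.conjTranspose_apply, smul_eq_mul, Finset.mul_sum]
    exact Finset.sum_congr rfl fun n _ => by ring
  have h4 : P.evolMatrix inv * B = B * Matrix.diagonal (fun n => Complex.exp (z * P.lam n)) := by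
    rw [Problem.evolMatrix, h3, Matrix.exp_conj _ _ hU, Matrix.exp_diagonal, mul_assoc,
      Matrix.nonsing_inv_mul _ ((Matrix.isUnit_iff_isUnit_det _).mp hU), mul_one]
    congr 2
    funext n
    rw [Pi.coe_exp, Complex.exp_eq_exp_ℂ]
  have h5 := congrFun (congrFun h4 s) n
  rw [Matrix.mul_apply, Matrix.mul_diagonal] at h5
  simpa [hB, mul_comm] using h5

/-- The state with energy amplitudes `c`. -/
noncomputable def Problem.synth (P : Problem D d b a)
    (c : W → ((j : Fin (D + 1)) → Fin (b j)) → Fin d → ℂ) : Reg W b d → ℂ :=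
  fun x => ∑ n, c x.1 x.2.1 n * P.ket n x.2.2

theorem apply_evol_synth (P : Problem D d b a) (inv : Bool) (ctrl : W → Bool)
    (c : W → ((j : Fin (D + 1)) → Fin (b j)) → Fin d → ℂ) :
    (Gate.evol inv ctrl).apply P (P.synth c) = P.synth fun w x n =>
      Complex.exp ((if inv then -Complex.I else Complex.I) * P.lam n * (if ctrl w then 1 else 0)) *
        c w x n := by
  funext x
  by_cases h : ctrl x.1
  · simp only [Gate.apply, h, if_true, Problem.synth, mul_one, Finset.mul_sum]
    rw [Finset.sum_comm]
    refine Finset.sum_congr rfl fun n _ => ?_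
    rw [mul_right_comm, ← P.evolMatrix_mulVec_ket, Finset.sum_mul]
    exact Finset.sum_congr rfl fun s _ => by rw [Problem.evolMatrix]; ring
  · simp [Gate.apply, h, Problem.synth]

theorem run_replicate_evol_synth (P : Problem D d b a) (inv : Bool) (ctrl : W → Bool) (r : ℕ)
    (c : W → ((j : Fin (D + 1)) → Fin (b j)) → Fin d → ℂ) :
    run P (List.replicate r (.evol inv ctrl)) (P.synth c) = P.synth fun w x n =>
      Complex.exp ((if inv then -Complex.I else Complex.I) * P.lam n *
        (r * (if ctrl w then 1 else 0) : ℕ)) * c w x n := by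
  induction r generalizing c with
  | zero => simp
  | succ r ih =>
    rw [List.replicate_succ, run_cons, apply_evol_synth, ih]
    congr 1
    funext w x n
    rw [← mul_assoc, ← Complex.exp_add]
    congr 2
    push_cast
    ring

/-- Binary expansion of the register value: after the bits below `r` the accumulated exponent is the
value modulo `2 ^ r`, and at `r = m` nothing is cut off. -/
theorem run_muxEvol_synth {m : ℕ} (P : Problem D d b a) (i : Fin D) (inv : Bool)
    (c : (Fin D → Fin (2 ^ m)) → ((j : Fin (D + 1)) → Fin (b j)) → Fin d → ℂ) :
    run P (muxEvol b d i inv) (P.synth c) = P.synth fun w x n =>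
      Complex.exp ((if inv then -Complex.I else Complex.I) * P.lam n * (w i : ℕ)) * c w x n := by
  have key : ∀ (r : ℕ) (c : (Fin D → Fin (2 ^ m)) → ((j : Fin (D + 1)) → Fin (b j)) → Fin d → ℂ),
      run P ((List.range r).flatMap fun k => List.replicate (2 ^ k)
        (.evol inv fun w => (w i : ℕ).testBit k)) (P.synth c) = P.synth fun w x n =>
      Complex.exp ((if inv then -Complex.I else Complex.I) * P.lam n *
        ((w i : ℕ) % 2 ^ r : ℕ)) * c w x n := by
    intro r
    induction r with
    | zero => intro c; simp [Nat.mod_one]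
    | succ r ih =>
      intro c
      rw [List.range_succ, List.flatMap_append, run_append, ih]
      simp only [List.flatMap_cons, List.flatMap_nil, List.append_nil]
      rw [run_replicate_evol_synth]
      congr 1
      funext w x n
      rw [← mul_assoc, ← Complex.exp_add, ← mul_add, ← Nat.cast_add]
      congr 4
      rw [Nat.mod_pow_succ, add_comm]
      congr 2
      rw [Nat.testBit_eq_decide_div_mod_eq]
      rcases Nat.mod_two_eq_zero_or_one ((w i : ℕ) / 2 ^ r) with h | h <;> simp [h]
  rw [muxEvol, key]
  congr 1
  funext w x n
  rw [Nat.mod_eq_of_lt (w i).2]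

theorem Problem.sum_synth (P : Problem D d b a) (f : Fin d → ℂ) (s : Fin d) :
    f s = ∑ n, (∑ s', star (P.ket n s') * f s') * P.ket n s := by
  simp_rw [Finset.sum_mul]
  rw [Finset.sum_comm]
  have : ∀ s', ∑ n, star (P.ket n s') * f s' * P.ket n s = f s' * if s = s' then 1 else 0 := by
    intro s'
    rw [← P.sum_ket_mul_star, Finset.mul_sum]
    exact Finset.sum_congr rfl fun n _ => by ring
  simp_rw [this]
  simp

theorem Problem.elem_eq (P : Problem D d b a) (j : Fin (D + 1)) (n n' : Fin d) :
    P.elem j n n' = ∑ s, star (P.ket n s) * ∑ s', P.V j s s' * P.ket n' s' := by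
  rw [Problem.elem, PiLp.inner_apply]
  refine Finset.sum_congr rfl fun s _ => ?_
  simp [Matrix.toEuclideanLin, Matrix.mulVec, dotProduct, mul_comm]

/-- A block-encoding whose ancilla is in the state `0` before and after acts as the encoded
operator; the other ancillas are not touched. -/
theorem apply_block_synth (P : Problem D d b a) (j : Fin (D + 1))
    (c : W → ((j : Fin (D + 1)) → Fin (b j)) → Fin d → ℂ)
    (hc : ∀ w x n, x j ≠ 0 → c w x n = 0) :
    ∃ c', (Gate.block j false).apply P (P.synth c) = P.synth c' ∧
      (∀ w n, c' w (fun _ => 0) n = ∑ n', P.elem j n n' / a j * c w (fun _ => 0) n') ∧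
      ∀ i, i ≠ j → (∀ w x n, x i ≠ 0 → c w x n = 0) → ∀ w x n, x i ≠ 0 → c' w x n = 0 := by
  set ψ := (Gate.block j false).apply P (P.synth c) with hψ
  refine ⟨fun w x n => ∑ s', star (P.ket n s') * ψ (w, x, s'), ?_, ?_, ?_⟩
  · funext x
    exact P.sum_synth (fun s => ψ (x.1, x.2.1, s)) x.2.2
  · intro w n
    have h0 : ∀ s, ψ (w, fun _ => 0, s) = ∑ n', (∑ s', P.V j s s' * P.ket n' s') / a j *
        c w (fun _ => 0) n' := by
      intro s
      simp only [hψ, Gate.apply, Fintype.sum_prod_type, Problem.synth]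
      rw [Finset.sum_eq_single 0]
      · have hu : Function.update (fun j : Fin (D + 1) => (0 : Fin (b j))) j 0 = fun _ => 0 := by
          funext k
          by_cases hk : k = j
          · subst hk; simp
          · simp [hk]
        simp only [hu, Bool.false_eq_true, if_false, P.block_encodes, Finset.mul_sum,
          Finset.sum_div, Finset.sum_mul]
        rw [Finset.sum_comm]
        exact Finset.sum_congr rfl fun n' _ => Finset.sum_congr rfl fun s' _ => by ring
      · intro y _ hy
        refine Finset.sum_eq_zero fun s' _ => ?_
        rw [Finset.sum_eq_zero, mul_zero]
        intro n' _
        rw [hc _ _ _ (by simpa using hy), zero_mul]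
      · simp
    simp_rw [h0, P.elem_eq, Finset.mul_sum]
    rw [Finset.sum_comm]
    refine Finset.sum_congr rfl fun n' _ => ?_
    rw [Finset.sum_div, Finset.sum_mul]
    refine Finset.sum_congr rfl fun s _ => ?_
    rw [Finset.sum_div, Finset.sum_div, Finset.sum_mul, Finset.sum_mul, Finset.mul_sum]
    exact Finset.sum_congr rfl fun n' _ => by ring
  -- Only ancilla `j` is changed, so the ancillas of the encodings still to come stay in `0`. This
  -- keeps the induction over the circuit going.
  · intro i hi hci w x n hx
    refine Finset.sum_eq_zero fun s _ => ?_
    rw [hψ]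
    simp only [Gate.apply, Problem.synth]
    rw [Finset.sum_eq_zero, mul_zero]
    intro y _
    rw [Finset.sum_eq_zero, mul_zero]
    intro n' _
    rw [hci _ _ _ (by simpa [hi] using hx), zero_mul]

end eigenbasis

/-! ### The interaction-picture operators and the sum over paths -/

section square

variable {D d m : ℕ} {b : Fin (D + 1) → ℕ}

/-- The multiplexed interaction-picture operators `V_I⁽⁰⁾(t_D) ⋯ V_I⁽ᴰ⁻¹⁾(t_1)` for the listed
time registers. -/
def interaction (m : ℕ) (b : Fin (D + 1) → ℕ) (d : ℕ) (l : List (Fin D)) :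
    Circuit (Fin D → Fin (2 ^ m)) b d :=
  l.flatMap fun i => muxEvol b d i true ++ [.block (Fin.rev i).castSucc false] ++ muxEvol b d i false

/-- The circuit for the complete square, with an arbitrary unitary for the preparation of the
time registers. -/
noncomputable def responseCircuit (b : Fin (D + 1) → ℕ) (d : ℕ)
    (U : Matrix.unitaryGroup (Reg (Fin D → Fin (2 ^ m)) b d) ℂ) :
    Circuit (Fin D → Fin (2 ^ m)) b d :=
  [.free U, .prep false, .block (Fin.last D) false] ++ interaction m b d (List.finRange D) ++
    [.free (onTime b d (invQFT (2 ^ m)))]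

theorem squareCircuit_eq (UL : Matrix.unitaryGroup (Fin (2 ^ m)) ℂ) :
    squareCircuit b d UL = responseCircuit b d (onTime b d UL) := rfl

variable [NeZero d] [∀ j, NeZero (b j)] {a : Fin (D + 1) → ℝ}

/-- Matrix elements of `V_I⁽ʲ⁾(t) / a j` in the energy eigenbasis. -/
noncomputable def Problem.interactionElem (P : Problem D d b a) (t : ℕ) (j : Fin (D + 1))
    (n n' : Fin d) : ℂ :=
  P.elem j n n' / a j * Complex.exp (Complex.I * ((t : ℕ) : ℂ) * ((P.lam n - P.lam n' : ℝ) : ℂ))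

/-- Since the list has no repetitions, each ancilla is used at most once and is in `0` beforehand.
The branch with all ancillas in `0` therefore receives contributions from that branch only, and it
evolves by a closed recursion; nothing need be known about the failed branches. -/
theorem run_interaction_synth (P : Problem D d b a) (l : List (Fin D)) (hl : l.Nodup)
    (c : (Fin D → Fin (2 ^ m)) → ((j : Fin (D + 1)) → Fin (b j)) → Fin d → ℂ)
    (hc : ∀ i ∈ l, ∀ w x n, x (Fin.rev i).castSucc ≠ 0 → c w x n = 0) :
    ∃ c', run P (interaction m b d l) (P.synth c) = P.synth c' ∧
      ∀ w, c' w (fun _ => 0) = l.foldl (fun v i n => ∑ n',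
        P.interactionElem (w i : ℕ) (Fin.rev i).castSucc n n' * v n') (c w fun _ => 0) := by
  induction l generalizing c with
  | nil => exact ⟨c, rfl, fun _ => rfl⟩
  | cons i l ih =>
    rw [List.nodup_cons] at hl
    obtain ⟨c1, h1, h2, h3⟩ := apply_block_synth P (Fin.rev i).castSucc
      (fun w x n => Complex.exp ((if true then -Complex.I else Complex.I) * P.lam n * (w i : ℕ)) *
        c w x n)
      (fun w x n hx => by rw [hc i List.mem_cons_self w x n hx, mul_zero])
    obtain ⟨c2, h4, h5⟩ := ih hl.2
      (fun w x n => Complex.exp ((if false then -Complex.I else Complex.I) * P.lam n * (w i : ℕ)) *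
        c1 w x n)
      (fun k hk w x n hx => by
        rw [h3 (Fin.rev k).castSucc _ _ w x n hx, mul_zero]
        · intro h
          exact hl.1 (Fin.rev_injective (Fin.castSucc_injective _ h) ▸ hk)
        · intro w x n hx
          rw [hc k (List.mem_cons_of_mem _ hk) w x n hx, mul_zero])
    refine ⟨c2, ?_, fun w => ?_⟩
    · rw [← h4, interaction, List.flatMap_cons, run_append, run_append, run_append,
        run_muxEvol_synth, run_cons, run_nil, h1, run_muxEvol_synth]
      rfl
    · rw [h5, List.foldl_cons]
      congr 1
      funext n
      rw [h2, Finset.mul_sum]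
      refine Finset.sum_congr rfl fun n' _ => ?_
      have : Complex.exp (Complex.I * ((w i : ℕ) : ℂ) * ((P.lam n - P.lam n' : ℝ) : ℂ))
          = Complex.exp (Complex.I * P.lam n * (w i : ℕ)) *
            Complex.exp (-Complex.I * P.lam n' * (w i : ℕ)) := by
        rw [← Complex.exp_add]
        congr 1
        push_cast
        ring
      simp only [if_true, Bool.false_eq_true, if_false, Problem.interactionElem, this]
      ring

/-- A product of matrices applied to a vector, as a sum over paths. -/
theorem foldl_finRange_eq_sum_paths {I : Type} [Fintype I] [DecidableEq I] (D : ℕ) (T : Fin D → I → I → ℂ)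
    (v : I → ℂ) (i0 : I) :
    (List.finRange D).foldl (fun v i n => ∑ n', T (Fin.rev i) n n' * v n') v i0 =
      ∑ n : Fin (D + 1) → I, if n 0 = i0 then
        v (n (Fin.last D)) * ∏ j : Fin D, T j (n j.castSucc) (n j.succ) else 0 := by
  induction D generalizing i0 with
  | zero =>
    rw [← (Equiv.funUnique (Fin 1) I).symm.sum_comp]
    simp [List.finRange_zero, Equiv.funUnique]
  | succ D ih =>
    -- The factor applied last is `T 0`, because the order is reversed; peeling it off extends the
    -- path at its front end `n 0`.
    rw [List.finRange_succ_last, List.foldl_append, List.foldl_map, List.foldl_cons, List.foldl_nil,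
      Fin.rev_last]
    simp_rw [Fin.rev_castSucc]
    rw [← (Fin.consEquiv fun _ => I).sum_comp, Fintype.sum_prod_type, Finset.sum_comm]
    simp only [Fin.consEquiv_apply, Fin.cons_zero, Finset.sum_ite_eq', Finset.mem_univ, if_true]
    simp_rw [ih (fun j => T j.succ), Finset.mul_sum]
    rw [Finset.sum_comm]
    refine Finset.sum_congr rfl fun n _ => ?_
    rw [Finset.sum_eq_single (n 0)]
    · rw [if_pos rfl, Fin.prod_univ_succ, ← Fin.succ_last, Fin.cons_succ]
      simp only [Fin.castSucc_zero, Fin.cons_zero, Fin.cons_succ, Fin.castSucc_succ]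
      ring
    · intro i _ hi
      rw [if_neg (Ne.symm hi), mul_zero]
    · simp

end square

/-! ### Outcome probabilities of the complete-square circuit -/

section response

variable {D d m : ℕ} [NeZero d] {b : Fin (D + 1) → ℕ} [∀ j, NeZero (b j)] {a : Fin (D + 1) → ℝ}

theorem apply_free_onTime (P : Problem D d b a) (U : Matrix.unitaryGroup (Fin (2 ^ m)) ℂ)
    (ψ : Reg (Fin D → Fin (2 ^ m)) b d → ℂ) (x : Reg (Fin D → Fin (2 ^ m)) b d) :
    (Gate.free (onTime b d U)).apply P ψ x = ∑ w, (∏ i, U.1 (x.1 i) (w i)) * ψ (w, x.2) := by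
  simp only [Gate.apply, onTime, Matrix.mulVec, dotProduct]
  rw [Fintype.sum_prod_type]
  refine Finset.sum_congr rfl fun w _ => ?_
  rw [Finset.sum_eq_single x.2]
  · simp [Matrix.kroneckerMap_apply, tensorPow]
  · intro y _ hy
    simp [Matrix.kroneckerMap_apply, Matrix.one_apply_ne (Ne.symm hy)]
  · simp

/-- The preparation of a product window, with phases that shift the frequencies by `φ`. -/
def PreparesWindow (α : Fin (2 ^ m) → ℂ) (φ : Fin D → ℝ)
    (U : Matrix.unitaryGroup (Reg (Fin D → Fin (2 ^ m)) b d) ℂ) : Prop :=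
  ∀ x, U.1 x (fun _ => 0, fun _ => 0, 0) = if x.2 = (fun _ => 0, 0) then
    ∏ i, α (x.1 i) * Complex.exp (-(Complex.I * ((x.1 i : ℕ) : ℂ) * φ i)) else 0

theorem preparesWindow_onTime (α : Fin (2 ^ m) → ℂ) (UL : Matrix.unitaryGroup (Fin (2 ^ m)) ℂ)
    (h : ∀ k, UL.1 k 0 = α k) : PreparesWindow α 0 (onTime b d UL) := by
  intro x
  by_cases hx : x.2 = (fun _ => 0, 0)
  · simp [onTime, Matrix.kroneckerMap_apply, tensorPow, h, hx, Matrix.one_apply]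
  · simp [onTime, Matrix.kroneckerMap_apply, tensorPow, hx]

/-- A diagonal unitary after the window preparation supplies the phases. It needs no oracle and
moves an arbitrary real frequency onto the grid. -/
theorem exists_preparesWindow (b : Fin (D + 1) → ℕ) [∀ j, NeZero (b j)] (d : ℕ) [NeZero d]
    (α : Fin (2 ^ m) → ℂ) (hα : ∑ k, ‖α k‖ ^ 2 = 1) (φ : Fin D → ℝ) :
    ∃ U : Matrix.unitaryGroup (Reg (Fin D → Fin (2 ^ m)) b d) ℂ, PreparesWindow α φ U := by
  obtain ⟨UL, hUL⟩ := exists_unitary_column α hα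
  let v : Reg (Fin D → Fin (2 ^ m)) b d → ℂ := fun x =>
    Complex.exp (((-∑ i, ((x.1 i : ℕ) : ℝ) * φ i : ℝ) : ℂ) * Complex.I)
  have hv : Matrix.diagonal v ∈ Matrix.unitaryGroup (Reg (Fin D → Fin (2 ^ m)) b d) ℂ := by
    rw [Matrix.mem_unitaryGroup_iff, Matrix.star_eq_conjTranspose, Matrix.diagonal_conjTranspose,
      Matrix.diagonal_mul_diagonal, ← Matrix.diagonal_one]
    congr 1
    funext x
    simp only [v, Pi.star_apply, Complex.star_def, Complex.mul_conj, Complex.normSq_eq_norm_sq,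
      Complex.norm_exp_ofReal_mul_I]
    simp
  refine ⟨⟨_, hv⟩ * onTime b d UL, fun x => ?_⟩
  have h := preparesWindow_onTime (b := b) (d := d) α UL hUL x
  simp only [Matrix.UnitaryGroup.mul_val, Matrix.diagonal_mul, h]
  split_ifs
  · simp only [Finset.prod_mul_distrib, ← Complex.exp_sum, Pi.zero_apply, Complex.ofReal_zero,
      mul_zero, neg_zero, Complex.exp_zero, mul_one, v]
    rw [mul_comm]
    congr 2
    push_cast
    rw [← Finset.sum_neg_distrib, Finset.sum_mul]
    exact Finset.sum_congr rfl fun i _ => by ring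
  · simp

/-- One time register: the phases of preparation, evolution and Fourier transform add up to `t`
times the argument of the window. -/
theorem sum_invQFT_mul_interactionElem (P : Problem D d b a) (α : Fin (2 ^ m) → ℂ) (φ : ℝ)
    (k : Fin (2 ^ m)) (j : Fin (D + 1)) (n n' : Fin d) :
    ∑ t : Fin (2 ^ m), (invQFT (2 ^ m)).1 k t *
      (α t * Complex.exp (-(Complex.I * ((t : ℕ) : ℂ) * φ))) * P.interactionElem t j n n' =
    (P.elem j n n' * window α (P.lam n - P.lam n' -
      (φ + 2 * Real.pi * (k : ℕ) / (2 ^ m : ℕ)))) / a j := by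
  rw [window, Finset.mul_sum, Finset.mul_sum, Finset.sum_div]
  refine Finset.sum_congr rfl fun t _ => ?_
  have : Complex.exp (Complex.I * ((t : ℕ) : ℂ) *
        ((P.lam n - P.lam n' - (φ + 2 * Real.pi * (k : ℕ) / (2 ^ m : ℕ)) : ℝ) : ℂ))
      = Complex.exp (-(2 * Real.pi * Complex.I * ((t : ℕ) : ℂ) * ((k : ℕ) : ℂ) /
          ((2 ^ m : ℕ) : ℂ))) * Complex.exp (-(Complex.I * ((t : ℕ) : ℂ) * φ)) *
        Complex.exp (Complex.I * ((t : ℕ) : ℂ) * ((P.lam n - P.lam n' : ℝ) : ℂ)) := by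
    rw [← Complex.exp_add, ← Complex.exp_add]
    congr 1
    push_cast
    ring
  rw [this]
  simp only [invQFT, invQFTMatrix, Matrix.of_apply, Problem.interactionElem]
  ring

/-- The amplitudes of the outcomes with successful block-encodings. -/
theorem output_responseCircuit (P : Problem D d b a) (α : Fin (2 ^ m) → ℂ) (φ : Fin D → ℝ)
    (U : Matrix.unitaryGroup (Reg (Fin D → Fin (2 ^ m)) b d) ℂ) (hU : PreparesWindow α φ U)
    (ω : Fin D → Fin (2 ^ m)) (s : Fin d) :
    output P (fun _ => 0) (responseCircuit b d U) (ω, fun _ => 0, s) =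
      (∑ n : Fin (D + 1) → Fin d,
        (P.elem (Fin.last D) (n (Fin.last D)) P.n0 *
          ∏ j : Fin D, P.elem j.castSucc (n j.castSucc) (n j.succ) *
            window α (P.lam (n j.castSucc) - P.lam (n j.succ) -
              (φ (Fin.rev j) + gridFreq ω (Fin.rev j)))) * P.ket (n 0) s) / ∏ j, (a j : ℂ) := by
  set ψ : (Fin D → Fin (2 ^ m)) → ℂ := fun w =>
    ∏ i, α (w i) * Complex.exp (-(Complex.I * ((w i : ℕ) : ℂ) * φ i)) with hψ
  -- the state after the preparations
  have h1 : run P [.free U, .prep false] (Pi.single (fun _ => 0, fun _ => 0, 0) 1)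
      = P.synth fun w x n => if x = (fun _ => 0) ∧ n = P.n0 then ψ w else 0 := by
    have h2 : (Gate.free U).apply P (Pi.single (fun _ => 0, fun _ => 0, 0) 1)
        = fun x => if x.2 = (fun _ => 0, 0) then ψ x.1 else 0 := by
      funext x
      rw [← hU x]
      simp only [Gate.apply, Matrix.mulVec_single_one, Matrix.col_apply]
    rw [run_cons, h2]
    funext x
    simp only [run_cons, run_nil, Gate.apply, Problem.synth, Bool.false_eq_true, if_false,
      Prod.mk.injEq]
    by_cases hx : x.2.1 = fun _ => 0
    · simp [hx, P.prepares, mul_comm]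
    · simp [hx]
  obtain ⟨c1, h2, h3, h4⟩ := apply_block_synth P (Fin.last D)
    (fun (w : Fin D → Fin (2 ^ m)) x n => if x = (fun _ => 0) ∧ n = P.n0 then ψ w else 0)
    (fun w x n hx => if_neg fun h => hx (by rw [h.1]))
  obtain ⟨c2, h5, h6⟩ := run_interaction_synth P (List.finRange D) (List.nodup_finRange D) c1
    (fun i _ => h4 _ (Fin.castSucc_lt_last _).ne fun w x n hx => if_neg fun h => hx (by rw [h.1]))
  have h7 : output P (fun _ => 0) (responseCircuit b d U)
      = (Gate.free (onTime b d (invQFT (2 ^ m)))).apply P (P.synth c2) := by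
    rw [← h5, ← h2, ← h1]
    change run P (responseCircuit b d U) _ = _
    simp only [responseCircuit, run_append, run_cons, run_nil]
  have h8 : ∀ w i0, c2 w (fun _ => 0) i0 = ∑ n : Fin (D + 1) → Fin d, if n 0 = i0 then
      P.elem (Fin.last D) (n (Fin.last D)) P.n0 / a (Fin.last D) * ψ w *
        ∏ j : Fin D, P.interactionElem (w (Fin.rev j) : ℕ) j.castSucc (n j.castSucc) (n j.succ)
      else 0 := by
    intro w i0
    have h9 := foldl_finRange_eq_sum_paths D (fun j n n' =>
      P.interactionElem (w (Fin.rev j) : ℕ) j.castSucc n n') (c1 w fun _ => 0) i0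
    simp only [Fin.rev_rev] at h9
    rw [h6, h9]
    refine Finset.sum_congr rfl fun n _ => ?_
    rw [h3]
    simp
  rw [h7, apply_free_onTime, Finset.sum_div]
  simp only [Problem.synth, h8, Finset.sum_mul, Finset.mul_sum, ite_mul, zero_mul]
  have h9 : ∀ w : Fin D → Fin (2 ^ m), ∑ i0, ∑ n : Fin (D + 1) → Fin d,
      (∏ i, (invQFT (2 ^ m)).1 (ω i) (w i)) * (if n 0 = i0 then
      P.elem (Fin.last D) (n (Fin.last D)) P.n0 / a (Fin.last D) * ψ w *
        (∏ j : Fin D, P.interactionElem (w (Fin.rev j) : ℕ) j.castSucc (n j.castSucc) (n j.succ)) *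
        P.ket i0 s else 0)
      = ∑ n : Fin (D + 1) → Fin d, (∏ i, (invQFT (2 ^ m)).1 (ω i) (w i)) *
      (P.elem (Fin.last D) (n (Fin.last D)) P.n0 / a (Fin.last D) * ψ w *
        (∏ j : Fin D, P.interactionElem (w (Fin.rev j) : ℕ) j.castSucc (n j.castSucc) (n j.succ)) *
        P.ket (n 0) s) := by
    intro w
    rw [Finset.sum_comm]
    refine Finset.sum_congr rfl fun n _ => ?_
    rw [← Finset.mul_sum, Finset.sum_ite_eq, if_pos (Finset.mem_univ _)]
  simp_rw [h9]
  rw [Finset.sum_comm]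
  refine Finset.sum_congr rfl fun n _ => ?_
  -- the sums over the times factorise
  have h10 : ∑ w : Fin D → Fin (2 ^ m), ∏ i, ((invQFT (2 ^ m)).1 (ω i) (w i) *
        (α (w i) * Complex.exp (-(Complex.I * ((w i : ℕ) : ℂ) * φ i))) *
        P.interactionElem (w i : ℕ) (Fin.rev i).castSucc (n (Fin.rev i).castSucc)
          (n (Fin.rev i).succ))
      = ∏ j : Fin D, (P.elem j.castSucc (n j.castSucc) (n j.succ) *
            window α (P.lam (n j.castSucc) - P.lam (n j.succ) -
              (φ (Fin.rev j) + gridFreq ω (Fin.rev j)))) / a j.castSucc := by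
    rw [← Fintype.prod_sum (fun i t => (invQFT (2 ^ m)).1 (ω i) t *
        (α t * Complex.exp (-(Complex.I * ((t : ℕ) : ℂ) * φ i))) *
        P.interactionElem (t : ℕ) (Fin.rev i).castSucc (n (Fin.rev i).castSucc)
          (n (Fin.rev i).succ)), ← Equiv.prod_comp Fin.revPerm]
    refine Finset.prod_congr rfl fun j _ => ?_
    simp only [Fin.revPerm_apply, Fin.rev_rev]
    rw [sum_invQFT_mul_interactionElem]
    rfl
  -- Register `i` drives the operator with index `Fin.rev i`; the product over operators is
  -- reindexed by registers to match the Fourier factors.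
  have h11 : ∀ w : Fin D → Fin (2 ^ m),
      ∏ j : Fin D, P.interactionElem (w (Fin.rev j) : ℕ) j.castSucc (n j.castSucc) (n j.succ)
      = ∏ i : Fin D, P.interactionElem (w i : ℕ) (Fin.rev i).castSucc (n (Fin.rev i).castSucc)
          (n (Fin.rev i).succ) := by
    intro w
    rw [← Equiv.prod_comp Fin.revPerm]
    simp
  rw [Fin.prod_univ_castSucc (fun j => (a j : ℂ))]
  rw [Finset.prod_div_distrib] at h10
  simp only [Finset.prod_mul_distrib] at h10 ⊢
  calc _ = P.elem (Fin.last D) (n (Fin.last D)) P.n0 / a (Fin.last D) * P.ket (n 0) s *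
        ∑ w : Fin D → Fin (2 ^ m), (∏ i, (invQFT (2 ^ m)).1 (ω i) (w i)) *
        ((∏ i, α (w i)) * ∏ i, Complex.exp (-(Complex.I * ((w i : ℕ) : ℂ) * φ i))) *
        ∏ i, P.interactionElem (w i : ℕ) (Fin.rev i).castSucc (n (Fin.rev i).castSucc)
          (n (Fin.rev i).succ) := by
        rw [Finset.mul_sum]
        refine Finset.sum_congr rfl fun w _ => ?_
        rw [h11, hψ]
        simp only [Finset.prod_mul_distrib]
        ring
    _ = _ := by
        rw [h10]
        ring

/-- The response as an outcome probability. -/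
theorem R2_eq (P : Problem D d b a) (ha : ∀ j, 0 < a j) (α : Fin (2 ^ m) → ℂ) (φ : Fin D → ℝ)
    (U : Matrix.unitaryGroup (Reg (Fin D → Fin (2 ^ m)) b d) ℂ) (hU : PreparesWindow α φ U)
    (ω : Fin D → Fin (2 ^ m)) :
    P.R2 α (φ + gridFreq ω) = (∏ j, a j) ^ 2 *
      ∑ s, outcomeProb P (fun _ => 0) (responseCircuit b d U) (ω, fun _ => 0, s) := by
  have hΩ : 0 < ∏ j, a j := Finset.prod_pos fun j _ => ha j
  have hΩC : ‖∏ j, (a j : ℂ)‖ = ∏ j, a j := by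
    rw [← Complex.ofReal_prod, Complex.norm_real, Real.norm_of_nonneg hΩ.le]
  rw [Problem.R2, EuclideanSpace.norm_sq_eq, Finset.mul_sum]
  refine Finset.sum_congr rfl fun s _ => ?_
  rw [outcomeProb, output_responseCircuit P α φ U hU, norm_div, hΩC, div_pow, mul_div_cancel₀]
  · simp [WithLp.ofLp_sum]
  · positivity

theorem squareProb_eq (P : Problem D d b a) (ha : ∀ j, 0 < a j) (α : Fin (2 ^ m) → ℂ)
    (UL : Matrix.unitaryGroup (Fin (2 ^ m)) ℂ) (h : ∀ k, UL.1 k 0 = α k)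
    (ω : Fin D → Fin (2 ^ m)) :
    P.R2 α (gridFreq ω) = (∏ j, a j) ^ 2 * squareProb P UL ω := by
  have := R2_eq P ha α 0 (onTime b d UL) (preparesWindow_onTime α UL h) ω
  rwa [zero_add] at this

end response

/-! ### Query counts -/

section queries

variable {W : Type} [Fintype W] [DecidableEq W] {D d m : ℕ} {b : Fin (D + 1) → ℕ}

theorem sum_range_two_pow (m : ℕ) : ((List.range m).map fun k => 2 ^ k).sum = 2 ^ m - 1 := by
  induction m with
  | zero => simp
  | succ m ih =>
    rw [List.range_succ, List.map_append, List.sum_append, ih]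
    have := Nat.one_le_two_pow (n := m)
    simp only [List.map_cons, List.map_nil, List.sum_cons, List.sum_nil, pow_succ]
    omega

@[simp] theorem evolQueries_append (C C' : Circuit W b d) :
    evolQueries (C ++ C') = evolQueries C + evolQueries C' := List.countP_append

@[simp] theorem blockQueries_append (j : Fin (D + 1)) (C C' : Circuit W b d) :
    blockQueries j (C ++ C') = blockQueries j C + blockQueries j C' := List.countP_append

@[simp] theorem prepQueries_append (C C' : Circuit W b d) :
    prepQueries (C ++ C') = prepQueries C + prepQueries C' := List.countP_append

theorem evolQueries_muxEvol (i : Fin D) (inv : Bool) :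
    evolQueries (muxEvol (m := m) b d i inv) = 2 ^ m - 1 := by
  rw [← sum_range_two_pow]
  simp [evolQueries, muxEvol, List.countP_flatMap, Function.comp_def, List.countP_replicate]

theorem blockQueries_muxEvol (j : Fin (D + 1)) (i : Fin D) (inv : Bool) :
    blockQueries j (muxEvol (m := m) b d i inv) = 0 := by
  simp [blockQueries, muxEvol, List.countP_flatMap, Function.comp_def, List.countP_replicate]

theorem prepQueries_muxEvol (i : Fin D) (inv : Bool) :
    prepQueries (muxEvol (m := m) b d i inv) = 0 := by
  simp [prepQueries, muxEvol, List.countP_flatMap, Function.comp_def, List.countP_replicate]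

theorem evolQueries_interaction (l : List (Fin D)) :
    evolQueries (interaction m b d l) = l.length * (2 * (2 ^ m - 1)) := by
  induction l with
  | nil => simp [interaction, evolQueries]
  | cons i l ih =>
    rw [interaction, List.flatMap_cons, evolQueries_append, evolQueries_append, evolQueries_append,
      evolQueries_muxEvol, evolQueries_muxEvol, ← interaction, ih, List.length_cons]
    simp only [evolQueries, List.countP_cons, List.countP_nil]
    simp
    ring

theorem blockQueries_interaction (j : Fin (D + 1)) (l : List (Fin D)) :
    blockQueries j (interaction m b d l) = l.countP fun i => (Fin.rev i).castSucc = j := by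
  induction l with
  | nil => simp [interaction, blockQueries]
  | cons i l ih =>
    rw [interaction, List.flatMap_cons, blockQueries_append, blockQueries_append,
      blockQueries_append, blockQueries_muxEvol, blockQueries_muxEvol, ← interaction, ih,
      List.countP_cons]
    simp only [blockQueries, List.countP_cons, List.countP_nil]
    omega

theorem prepQueries_interaction (l : List (Fin D)) : prepQueries (interaction m b d l) = 0 := by
  induction l with
  | nil => simp [interaction, prepQueries]
  | cons i l ih =>
    rw [interaction, List.flatMap_cons, prepQueries_append, prepQueries_append,
      prepQueries_append, prepQueries_muxEvol, prepQueries_muxEvol, ← interaction, ih]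
    simp [prepQueries]

theorem evolQueries_responseCircuit (U : Matrix.unitaryGroup (Reg (Fin D → Fin (2 ^ m)) b d) ℂ) :
    evolQueries (responseCircuit b d U) = D * (2 * (2 ^ m - 1)) := by
  rw [responseCircuit, evolQueries_append, evolQueries_append, evolQueries_interaction]
  simp [evolQueries]

/-- Reversal matches the `D` time registers bijectively with the operators other than the last, and
the last one is applied once at the start. -/
theorem blockQueries_responseCircuit (j : Fin (D + 1))
    (U : Matrix.unitaryGroup (Reg (Fin D → Fin (2 ^ m)) b d) ℂ) :
    blockQueries j (responseCircuit b d U) = 1 := by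
  rw [responseCircuit, blockQueries_append, blockQueries_append, blockQueries_interaction]
  rcases Fin.eq_castSucc_or_eq_last j with ⟨i, rfl⟩ | rfl
  · have h : (List.finRange D).countP (fun k => (Fin.rev k).castSucc = i.castSucc) = 1 := by
      have h1 : ∀ k : Fin D, ((Fin.rev k).castSucc = i.castSucc) ↔ k = Fin.rev i := by
        intro k
        rw [Fin.castSucc_inj]
        exact Fin.rev_eq_iff
      simp_rw [h1]
      exact List.count_eq_one_of_mem (List.nodup_finRange D) (List.mem_finRange _)
    rw [h]
    simp [blockQueries, (Fin.castSucc_lt_last i).ne']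
  · have h : (List.finRange D).countP (fun k => (Fin.rev k).castSucc = Fin.last D) = 0 := by
      rw [List.countP_eq_zero]
      intro k _
      simp
    rw [h]
    simp [blockQueries]

theorem prepQueries_responseCircuit (U : Matrix.unitaryGroup (Reg (Fin D → Fin (2 ^ m)) b d) ℂ) :
    prepQueries (responseCircuit b d U) = 1 := by
  rw [responseCircuit, prepQueries_append, prepQueries_append, prepQueries_interaction]
  simp [prepQueries]

end queries

/-! ### Amplitude estimation -/

theorem submatrix_mem_unitaryGroup {ι κ : Type*} [Fintype ι] [DecidableEq ι] [Fintype κ]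
    [DecidableEq κ] (e : κ ≃ ι) {U : Matrix ι ι ℂ} (hU : U ∈ Matrix.unitaryGroup ι ℂ) :
    U.submatrix e e ∈ Matrix.unitaryGroup κ ℂ := by
  rw [Matrix.mem_unitaryGroup_iff, Matrix.star_eq_conjTranspose] at hU ⊢
  rw [Matrix.conjTranspose_submatrix, Matrix.submatrix_mul_equiv, hU, Matrix.submatrix_one_equiv]

/-- The diagonal unitary that flips the sign of the basis states in `s`. -/
def signGate {ι : Type*} [Fintype ι] [DecidableEq ι] (s : ι → Bool) : Matrix.unitaryGroup ι ℂ :=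
  ⟨Matrix.diagonal fun x => if s x then -1 else 1, by
    rw [Matrix.mem_unitaryGroup_iff, Matrix.star_eq_conjTranspose, Matrix.diagonal_conjTranspose,
      Matrix.diagonal_mul_diagonal, ← Matrix.diagonal_one]
    congr 1
    funext x
    by_cases h : s x <;> simp [h]⟩

section lift

variable {W : Type} [Fintype W] [DecidableEq W] {D d : ℕ} {b : Fin (D + 1) → ℕ} {M : ℕ}

/-- A unitary on an additional phase register. -/
def onPhase (W : Type) [Fintype W] [DecidableEq W] (b : Fin (D + 1) → ℕ) (d : ℕ)
    (V : Matrix.unitaryGroup (Fin M) ℂ) : Matrix.unitaryGroup (Reg (Fin M × W) b d) ℂ :=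
  ⟨(V.1 ⊗ₖ (1 : Matrix (Reg W b d) _ ℂ)).submatrix (Equiv.prodAssoc _ _ _)
    (Equiv.prodAssoc _ _ _),
    submatrix_mem_unitaryGroup _ (Matrix.kronecker_mem_unitary V.2 (one_mem _))⟩

/-- A unitary that does not involve the phase register. -/
def offPhase (M : ℕ) (U : Matrix.unitaryGroup (Reg W b d) ℂ) :
    Matrix.unitaryGroup (Reg (Fin M × W) b d) ℂ :=
  ⟨((1 : Matrix (Fin M) _ ℂ) ⊗ₖ U.1).submatrix (Equiv.prodAssoc _ _ _)
    (Equiv.prodAssoc _ _ _),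
    submatrix_mem_unitaryGroup _ (Matrix.kronecker_mem_unitary (one_mem _) U.2)⟩

/-- A gate in the presence of a phase register. -/
def Gate.lift (M : ℕ) : Gate W b d → Gate (Fin M × W) b d
  | .free U => .free (offPhase M U)
  | .evol i c => .evol i fun w => c w.2
  | .block j i => .block j i
  | .prep i => .prep i

/-- A circuit in the presence of a phase register. -/
def liftCircuit (M : ℕ) (C : Circuit W b d) : Circuit (Fin M × W) b d := C.map (Gate.lift M)

/-- The state of the other registers for the value `y` of the phase register. -/
def slice (ψ : Reg (Fin M × W) b d → ℂ) (y : Fin M) : Reg W b d → ℂ :=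
  fun x => ψ ((y, x.1), x.2)

variable [NeZero d] [∀ j, NeZero (b j)] {a : Fin (D + 1) → ℝ}

theorem apply_signGate (P : Problem D d b a) (s : Reg W b d → Bool) (ψ : Reg W b d → ℂ)
    (x : Reg W b d) :
    (Gate.free (signGate s)).apply P ψ x = (if s x then -1 else 1) * ψ x := by
  simp [Gate.apply, signGate, Matrix.mulVec_diagonal]

theorem slice_apply_onPhase (P : Problem D d b a) (V : Matrix.unitaryGroup (Fin M) ℂ)
    (ψ : Reg (Fin M × W) b d → ℂ) (y : Fin M) :
    slice ((Gate.free (onPhase W b d V)).apply P ψ) y = fun x => ∑ k, V.1 y k * slice ψ k x := by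
  funext x
  simp only [slice, Gate.apply, onPhase, Matrix.mulVec, dotProduct, Matrix.submatrix_apply]
  rw [← (Equiv.prodAssoc (Fin M) W _).symm.sum_comp, Fintype.sum_prod_type]
  refine Finset.sum_congr rfl fun k _ => ?_
  rw [Finset.sum_eq_single x]
  · simp [Matrix.kroneckerMap_apply]
  · intro z _ hz
    simp [Matrix.kroneckerMap_apply, Matrix.one_apply_ne (Ne.symm hz)]
  · simp

theorem slice_apply_lift (P : Problem D d b a) (g : Gate W b d)
    (ψ : Reg (Fin M × W) b d → ℂ) (y : Fin M) :
    slice ((g.lift M).apply P ψ) y = g.apply P (slice ψ y) := by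
  cases g with
  | free U =>
    funext x
    simp only [slice, Gate.apply, Gate.lift, offPhase, Matrix.mulVec, dotProduct,
      Matrix.submatrix_apply]
    rw [← (Equiv.prodAssoc (Fin M) W _).symm.sum_comp, Fintype.sum_prod_type,
      Finset.sum_eq_single y]
    · simp [Matrix.kroneckerMap_apply]
    · intro z _ hz
      simp [Matrix.kroneckerMap_apply, Matrix.one_apply_ne (Ne.symm hz)]
    · simp
  | evol i c => rfl
  | block j i => rfl
  | prep i => rfl

theorem slice_run_liftCircuit (P : Problem D d b a) (C : Circuit W b d)
    (ψ : Reg (Fin M × W) b d → ℂ) (y : Fin M) :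
    slice (run P (liftCircuit M C) ψ) y = run P C (slice ψ y) := by
  induction C generalizing ψ with
  | nil => rfl
  | cons g C ih =>
    change slice (run P (liftCircuit M C) ((g.lift M).apply P ψ)) y = _
    rw [ih, slice_apply_lift, run_cons]

/-! ### The Grover operator and its invariant plane -/

/-- The Grover operator of the circuit `C` and the good basis states `S`. -/
noncomputable def grover (P : Problem D d b a) (w0 : W) (C : Circuit W b d) (S : Reg W b d → Bool)
    (ψ : Reg W b d → ℂ) : Reg W b d → ℂ :=
  run P (.free (signGate S) :: (invCircuit C ++
    (.free (signGate fun x => x ≠ (w0, fun _ => 0, 0)) :: C))) ψ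

/-- The `k`-th controlled Grover operator, applied if the phase register is greater than `k`. -/
def groverStep (M : ℕ) (w0 : W) (C : Circuit W b d) (S : Reg W b d → Bool) (k : ℕ) :
    Circuit (Fin M × W) b d :=
  .free (signGate fun x => k < x.1.1 && S (x.1.2, x.2)) :: (liftCircuit M (invCircuit C) ++
    (.free (signGate fun x => k < x.1.1 && (x.1.2, x.2) ≠ (w0, fun _ => 0, 0)) ::
      liftCircuit M C))

/-- Only the two sign flips are controlled. When they are switched off, the inverse circuit and the
circuit cancel, so the oracle calls inside need no additional control. -/
theorem slice_run_groverStep (P : Problem D d b a) (w0 : W) (C : Circuit W b d)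
    (S : Reg W b d → Bool) (k : ℕ) (ψ : Reg (Fin M × W) b d → ℂ) (y : Fin M) :
    slice (run P (groverStep M w0 C S k) ψ) y =
      if k < y then grover P w0 C S (slice ψ y) else slice ψ y := by
  have key : ∀ (R : Reg W b d → Bool) (χ : Reg (Fin M × W) b d → ℂ),
      slice ((Gate.free (signGate fun x => k < x.1.1 && R (x.1.2, x.2))).apply P χ) y =
        if k < y then (Gate.free (signGate R)).apply P (slice χ y) else slice χ y := by
    intro R χ
    funext x
    simp only [slice, apply_signGate]
    split_ifs with h1 h2 <;> simp_all [slice, apply_signGate]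
  rw [groverStep, run_cons, run_append, run_cons, slice_run_liftCircuit,
    key (fun x => x ≠ (w0, fun _ => 0, 0)), slice_run_liftCircuit, key S]
  split_ifs
  · simp [grover]
  · exact run_run_invCircuit P C _

theorem grover_linear (P : Problem D d b a) (w0 : W) (C : Circuit W b d) (S : Reg W b d → Bool)
    (r s : ℂ) (χ ψ : Reg W b d → ℂ) : grover P w0 C S (r • χ + s • ψ) =
      r • grover P w0 C S χ + s • grover P w0 C S ψ := run_linear P _ r s χ ψ

theorem grover_iterate_linear (P : Problem D d b a) (w0 : W) (C : Circuit W b d)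
    (S : Reg W b d → Bool) (k : ℕ) (r s : ℂ) (χ ψ : Reg W b d → ℂ) :
    (grover P w0 C S)^[k] (r • χ + s • ψ) =
      r • (grover P w0 C S)^[k] χ + s • (grover P w0 C S)^[k] ψ := by
  induction k generalizing χ ψ with
  | zero => rfl
  | succ k ih => rw [Function.iterate_succ_apply, grover_linear, ih, Function.iterate_succ_apply,
      Function.iterate_succ_apply]

/-- The Grover operator is a product of two reflections. -/
theorem grover_apply (P : Problem D d b a) (w0 : W) (C : Circuit W b d) (S : Reg W b d → Bool)
    (ψ : Reg W b d → ℂ) (x : Reg W b d) :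
    grover P w0 C S ψ x = 2 * (star (output P w0 C) ⬝ᵥ fun x => (if S x then -1 else 1) * ψ x) *
      output P w0 C x - (if S x then -1 else 1) * ψ x := by
  set e0 : Reg W b d → ℂ := Pi.single (w0, fun _ => 0, 0) 1 with he0
  set χ : Reg W b d → ℂ := fun x => (if S x then -1 else 1) * ψ x with hχ
  have h1 : (Gate.free (signGate S)).apply P ψ = χ := funext fun x => apply_signGate P S ψ x
  -- Flipping the sign of every basis state except the initial one is the reflection `2 |e0⟩⟨e0| -
  -- 1`.
  have h2 : ∀ ζ : Reg W b d → ℂ, (Gate.free (signGate fun x => x ≠ (w0, fun _ => 0, 0))).apply P ζ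
      = (2 * (star e0 ⬝ᵥ ζ)) • e0 + (-1 : ℂ) • ζ := by
    intro ζ
    funext x
    have h3 : star e0 ⬝ᵥ ζ = ζ (w0, fun _ => 0, 0) := by
      rw [he0, ← Pi.single_star, star_one, single_one_dotProduct]
    rw [apply_signGate, h3]
    by_cases hx : x = (w0, fun _ => 0, 0)
    · simp [hx, he0]
      ring
    · simp [hx, he0]
  have h3 : star e0 ⬝ᵥ run P (invCircuit C) χ = star (output P w0 C) ⬝ᵥ χ := by
    rw [dotProduct_run, invCircuit_invCircuit]
    rfl
  rw [grover, run_cons, run_append, run_cons, h1, h2, run_linear, run_run_invCircuit, h3]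
  simp only [Pi.add_apply, Pi.smul_apply, smul_eq_mul]
  change 2 * (star (output P w0 C) ⬝ᵥ χ) * output P w0 C x + -1 * χ x = _
  ring

/-- The probability of the good basis states. -/
noncomputable def goodProb (P : Problem D d b a) (w0 : W) (C : Circuit W b d)
    (S : Reg W b d → Bool) : ℝ :=
  ∑ x, if S x then outcomeProb P w0 C x else 0

/-- The eigenvectors of the Grover operator in the plane spanned by the good and the bad part of
the output of the circuit. -/
noncomputable def groverVec (P : Problem D d b a) (w0 : W) (C : Circuit W b d)
    (S : Reg W b d → Bool) (c s : ℝ) : Reg W b d → ℂ :=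
  fun x => (if S x then -(Complex.I * (s : ℂ)⁻¹) else (c : ℂ)⁻¹) * output P w0 C x

theorem goodProb_nonneg (P : Problem D d b a) (w0 : W) (C : Circuit W b d)
    (S : Reg W b d → Bool) : 0 ≤ goodProb P w0 C S :=
  Finset.sum_nonneg fun x _ => by
    split_ifs
    · exact sq_nonneg _
    · exact le_rfl

theorem sum_bad_eq (P : Problem D d b a) (w0 : W) (C : Circuit W b d) (S : Reg W b d → Bool) :
    ∑ x, (if S x then 0 else outcomeProb P w0 C x) = 1 - goodProb P w0 C S := by
  rw [← sum_outcomeProb P w0 C, goodProb, ← Finset.sum_sub_distrib]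
  refine Finset.sum_congr rfl fun x _ => ?_
  split_ifs <;> simp

theorem goodProb_le_one (P : Problem D d b a) (w0 : W) (C : Circuit W b d)
    (S : Reg W b d → Bool) : goodProb P w0 C S ≤ 1 := by
  rw [← sub_nonneg, ← sum_bad_eq]
  refine Finset.sum_nonneg fun x _ => ?_
  split_ifs
  · exact le_rfl
  · exact sq_nonneg _

theorem output_eq_zero_of_good (P : Problem D d b a) (w0 : W) (C : Circuit W b d)
    (S : Reg W b d → Bool) (h : goodProb P w0 C S = 0) {x : Reg W b d} (hx : S x) :
    output P w0 C x = 0 := by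
  have h5 := (Finset.sum_eq_zero_iff_of_nonneg (fun x _ => by
    split_ifs
    · exact sq_nonneg _
    · exact le_rfl)).mp h x (Finset.mem_univ x)
  rw [if_pos hx] at h5
  exact norm_eq_zero.mp (pow_eq_zero_iff two_ne_zero |>.mp h5)

theorem output_eq_zero_of_bad (P : Problem D d b a) (w0 : W) (C : Circuit W b d)
    (S : Reg W b d → Bool) (h : goodProb P w0 C S = 1) {x : Reg W b d} (hx : ¬ S x) :
    output P w0 C x = 0 := by
  have h0 := sum_bad_eq P w0 C S
  rw [h, sub_self] at h0
  have h5 := (Finset.sum_eq_zero_iff_of_nonneg (fun x _ => by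
    split_ifs
    · exact le_rfl
    · exact sq_nonneg _)).mp h0 x (Finset.mem_univ x)
  rw [if_neg hx] at h5
  exact norm_eq_zero.mp (pow_eq_zero_iff two_ne_zero |>.mp h5)

/-- The bad and good parts of the output have squared norms `c²` and `s²`. In their plane the two
reflections compose to a rotation by `2θ` with `c + is = e^{iθ}`, and bad part over `c` minus `i`
times good part over `s` is an eigenvector. The sign of `s` selects which of the two. -/
theorem grover_groverVec (P : Problem D d b a) (w0 : W) (C : Circuit W b d) (S : Reg W b d → Bool)
    {c s : ℝ} (hs : s ^ 2 = goodProb P w0 C S) (hc : c ^ 2 = 1 - goodProb P w0 C S) :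
    grover P w0 C S (groverVec P w0 C S c s) =
      ((c : ℂ) + Complex.I * s) ^ 2 • groverVec P w0 C S c s := by
  set φ := output P w0 C with hφ
  have hcs : (c : ℂ) ^ 2 + (s : ℂ) ^ 2 = 1 := by
    have : c ^ 2 + s ^ 2 = 1 := by rw [hs, hc]; ring
    exact_mod_cast this
  have hI := Complex.I_sq
  -- This includes `z = 0`, where `z⁻¹ = 0`, and so covers success probability `0` or `1`.
  have hmi : ∀ z : ℂ, z⁻¹ * z ^ 2 = z := by
    intro z
    by_cases hz : z = 0
    · simp [hz]
    · field_simp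
  have h1 : star φ ⬝ᵥ (fun x => (if S x then -1 else 1) * groverVec P w0 C S c s x)
      = (c : ℂ) + Complex.I * s := by
    have h2 : ∀ x, star (φ x) * ((if S x then -1 else 1) * groverVec P w0 C S c s x)
        = (c : ℂ)⁻¹ * ((if S x then 0 else outcomeProb P w0 C x : ℝ) : ℂ) +
          Complex.I * (s : ℂ)⁻¹ * ((if S x then outcomeProb P w0 C x else 0 : ℝ) : ℂ) := by
      intro x
      have h3 : star (φ x) * φ x = ((outcomeProb P w0 C x : ℝ) : ℂ) := by
        rw [outcomeProb, Complex.star_def, Complex.conj_mul']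
        push_cast
        rfl
      rw [groverVec, ← hφ]
      split_ifs <;> simp only [Complex.ofReal_zero]
      · linear_combination (Complex.I * (s : ℂ)⁻¹) * h3
      · linear_combination ((c : ℂ)⁻¹) * h3
    simp only [dotProduct, Pi.star_apply, h2]
    rw [Finset.sum_add_distrib, ← Finset.mul_sum, ← Finset.mul_sum, ← Complex.ofReal_sum,
      ← Complex.ofReal_sum, sum_bad_eq, ← goodProb, ← hc, ← hs]
    push_cast
    rw [hmi, mul_assoc, hmi]
  funext x
  rw [grover_apply, ← hφ, h1, Pi.smul_apply, smul_eq_mul, groverVec, ← hφ]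
  by_cases hx : S x
  · simp only [hx, if_true]
    by_cases hs0 : s = 0
    · have h4 : φ x = 0 := output_eq_zero_of_good P w0 C S (by rw [← hs, hs0]; norm_num) hx
      simp [h4]
    · have hsC : (s : ℂ) ≠ 0 := by exact_mod_cast hs0
      field_simp
      linear_combination (φ x) * (Complex.I * hcs + (2 * s * c + Complex.I * s ^ 2) * hI)
  · simp only [hx]
    by_cases hc0 : c = 0
    · have h4 : φ x = 0 := output_eq_zero_of_bad P w0 C S
        (by rw [hc0] at hc; linarith) hx
      simp [h4]
    · have hcC : (c : ℂ) ≠ 0 := by exact_mod_cast hc0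
      simp only [Bool.false_eq_true, if_false]
      field_simp
      linear_combination (φ x) * (hcs - s ^ 2 * hI)

theorem grover_iterate_groverVec (P : Problem D d b a) (w0 : W) (C : Circuit W b d)
    (S : Reg W b d → Bool) {c s : ℝ} (hs : s ^ 2 = goodProb P w0 C S)
    (hc : c ^ 2 = 1 - goodProb P w0 C S) (k : ℕ) :
    (grover P w0 C S)^[k] (groverVec P w0 C S c s) =
      (((c : ℂ) + Complex.I * s) ^ 2) ^ k • groverVec P w0 C S c s := by
  induction k with
  | zero => simp
  | succ k ih =>
    have h := grover_linear P w0 C S ((((c : ℂ) + Complex.I * s) ^ 2) ^ k) 0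
      (groverVec P w0 C S c s) 0
    rw [zero_smul, zero_smul, add_zero, add_zero, grover_groverVec P w0 C S hs hc, smul_smul] at h
    rw [Function.iterate_succ_apply', ih, h, pow_succ _ k]

theorem sum_norm_sq_groverVec_le (P : Problem D d b a) (w0 : W) (C : Circuit W b d)
    (S : Reg W b d → Bool) {c s : ℝ} (hs : s ^ 2 = goodProb P w0 C S)
    (hc : c ^ 2 = 1 - goodProb P w0 C S) :
    ∑ x, ‖groverVec P w0 C S c s x‖ ^ 2 ≤ 2 := by
  have h1 : ∀ x, ‖groverVec P w0 C S c s x‖ ^ 2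
      = (s ^ 2)⁻¹ * (if S x then outcomeProb P w0 C x else 0) +
        (c ^ 2)⁻¹ * (if S x then 0 else outcomeProb P w0 C x) := by
    intro x
    rw [groverVec, norm_mul, mul_pow, outcomeProb]
    split_ifs <;> simp
  simp_rw [h1]
  rw [Finset.sum_add_distrib, ← Finset.mul_sum, ← Finset.mul_sum, sum_bad_eq, ← goodProb, ← hc,
    ← hs]
  -- Each part contributes `1`, or `0` if it is absent; hence an inequality.
  have h2 : ∀ z : ℝ, z⁻¹ * z ≤ 1 := fun z => inv_mul_le_one
  linarith [h2 (s ^ 2), h2 (c ^ 2)]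

theorem output_eq_groverVec (P : Problem D d b a) (w0 : W) (C : Circuit W b d)
    (S : Reg W b d → Bool) {c s : ℝ} (hs : s ^ 2 = goodProb P w0 C S)
    (hc : c ^ 2 = 1 - goodProb P w0 C S) :
    output P w0 C = (((c : ℂ) + Complex.I * s) / 2) • groverVec P w0 C S c s +
      (((c : ℂ) - Complex.I * s) / 2) • groverVec P w0 C S c (-s) := by
  funext x
  simp only [Pi.add_apply, Pi.smul_apply, smul_eq_mul, groverVec]
  have hI := Complex.I_sq
  by_cases hx : S x
  · simp only [hx, if_true]
    by_cases hs0 : s = 0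
    · simp [output_eq_zero_of_good P w0 C S (by rw [← hs, hs0]; norm_num) hx]
    · have hsC : (s : ℂ) ≠ 0 := by exact_mod_cast hs0
      push_cast
      field_simp
      linear_combination (2 * s * output P w0 C x) * hI
  · simp only [hx]
    by_cases hc0 : c = 0
    · simp [output_eq_zero_of_bad P w0 C S (by rw [hc0] at hc; linarith) hx]
    · have hcC : (c : ℂ) ≠ 0 := by exact_mod_cast hc0
      simp only [Bool.false_eq_true, if_false]
      field_simp
      ring

/-! ### Phase estimation of the Grover operator -/

/-- The amplitude estimation circuit: phase estimation of the Grover operator with the window that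
`V` prepares. -/
noncomputable def amplitudeCircuit (V : Matrix.unitaryGroup (Fin M) ℂ) (w0 : W)
    (C : Circuit W b d) (S : Reg W b d → Bool) : Circuit (Fin M × W) b d :=
  .free (onPhase W b d V) :: (liftCircuit M C ++ ((List.range M).flatMap (groverStep M w0 C S) ++
    [.free (onPhase W b d (invQFT M))]))

/-- Control is unary: step `k` acts on the register value `y` exactly when `k < y`, so the number of
active steps is the required power. -/
theorem slice_run_flatMap_groverStep (P : Problem D d b a) (w0 : W) (C : Circuit W b d)
    (S : Reg W b d → Bool) (r : ℕ) (ψ : Reg (Fin M × W) b d → ℂ) (y : Fin M) :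
    slice (run P ((List.range r).flatMap (groverStep M w0 C S)) ψ) y =
      (grover P w0 C S)^[min r y] (slice ψ y) := by
  induction r with
  | zero => simp
  | succ r ih =>
    rw [List.range_succ, List.flatMap_append, run_append]
    simp only [List.flatMap_cons, List.flatMap_nil, List.append_nil]
    rw [slice_run_groverStep, ih]
    split_ifs with h
    · rw [min_eq_left h.le, min_eq_left (Nat.succ_le_of_lt h), Function.iterate_succ_apply']
    · rw [min_eq_right (not_lt.mp h), min_eq_right (le_trans (not_lt.mp h) (Nat.le_succ r))]

theorem slice_output_amplitudeCircuit [NeZero M] (P : Problem D d b a)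
    (V : Matrix.unitaryGroup (Fin M) ℂ) (w0 : W) (C : Circuit W b d) (S : Reg W b d → Bool)
    (y : Fin M) (x : Reg W b d) :
    slice (output P (0, w0) (amplitudeCircuit V w0 C S)) y x =
      ∑ k, (invQFT M).1 y k * (V.1 k 0 * (grover P w0 C S)^[k] (output P w0 C) x) := by
  set e0 : Reg (Fin M × W) b d → ℂ := Pi.single ((0, w0), fun _ => 0, 0) 1 with he0
  have h0 : ∀ k, slice e0 k = (if k = 0 then (1 : ℂ) else 0) •
      (Pi.single (w0, fun _ => 0, 0) 1 : Reg W b d → ℂ) := by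
    intro k
    funext x
    by_cases hk : k = 0
    · subst hk
      by_cases hx : x = (w0, fun _ => 0, 0)
      · simp [slice, he0, hx]
      · have : (((0 : Fin M), x.1), x.2) ≠ ((0, w0), fun _ => 0, 0) := by
          intro h
          exact hx (Prod.ext (congrArg (fun z => z.1.2) h) (congrArg (fun z => z.2) h))
        simp [slice, he0, hx, Pi.single_eq_of_ne this]
    · have : ((k, x.1), x.2) ≠ (((0 : Fin M), w0), fun _ => 0, 0) := fun h =>
        hk (congrArg (fun z => z.1.1) h)
      rw [if_neg hk, zero_smul]
      simp [slice, he0, Pi.single_eq_of_ne this]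
  have h1 : ∀ k, slice ((Gate.free (onPhase W b d V)).apply P e0) k
      = V.1 k 0 • (Pi.single (w0, fun _ => 0, 0) 1 : Reg W b d → ℂ) := by
    intro k
    rw [slice_apply_onPhase]
    funext x
    simp [h0]
  change slice (run P (amplitudeCircuit V w0 C S) e0) y x = _
  rw [amplitudeCircuit, run_cons, run_append, run_append, run_cons, run_nil, slice_apply_onPhase]
  refine Finset.sum_congr rfl fun k _ => ?_
  rw [slice_run_flatMap_groverStep, slice_run_liftCircuit, h1, min_eq_right k.2.le]
  have h2 := run_linear P C (V.1 k 0) 0 (Pi.single (w0, fun _ => 0, 0) 1) 0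
  rw [zero_smul, zero_smul, add_zero, add_zero] at h2
  have h3 := grover_iterate_linear P w0 C S k (V.1 k 0) 0 (output P w0 C) 0
  rw [zero_smul, zero_smul, add_zero, add_zero] at h3
  rw [h2]
  change _ * (grover P w0 C S)^[k] (V.1 k 0 • output P w0 C) x = _
  rw [h3]
  rfl

/-- The outcome distribution of amplitude estimation. -/
theorem sum_outcomeProb_amplitudeCircuit_le [NeZero M] (P : Problem D d b a)
    (α : Fin M → ℂ) (V : Matrix.unitaryGroup (Fin M) ℂ) (hV : ∀ k, V.1 k 0 = α k) (w0 : W)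
    (C : Circuit W b d) (S : Reg W b d → Bool) {θ : ℝ}
    (hs : Real.sin θ ^ 2 = goodProb P w0 C S) (y : Fin M) :
    ∑ x : Reg W b d, outcomeProb P (0, w0) (amplitudeCircuit V w0 C S) ((y, x.1), x.2) ≤
      ‖window α (2 * θ - 2 * Real.pi * (y : ℕ) / M)‖ ^ 2 +
        ‖window α (-(2 * θ) - 2 * Real.pi * (y : ℕ) / M)‖ ^ 2 := by
  set c := Real.cos θ with hc'
  set s := Real.sin θ with hs'
  have hc : c ^ 2 = 1 - goodProb P w0 C S := by
    rw [← hs]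
    linarith [Real.sin_sq_add_cos_sq θ]
  have hsn : (-s) ^ 2 = goodProb P w0 C S := by rw [neg_sq, hs]
  have he : ((c : ℂ) + Complex.I * s) = Complex.exp (Complex.I * θ) := by
    rw [mul_comm Complex.I (θ : ℂ), Complex.exp_mul_I, hc', hs']
    push_cast
    ring
  have hen : ((c : ℂ) + Complex.I * ((-s : ℝ) : ℂ)) = Complex.exp (-(Complex.I * θ)) := by
    rw [mul_comm Complex.I (θ : ℂ), ← neg_mul, Complex.exp_mul_I, Complex.cos_neg,
      Complex.sin_neg, hc', hs']
    push_cast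
    ring
  set u := groverVec P w0 C S c s with hu
  set v := groverVec P w0 C S c (-s) with hv
  have h1 : ∀ (k : ℕ) x, (grover P w0 C S)^[k] (output P w0 C) x =
      Complex.exp (Complex.I * θ) / 2 * (Complex.exp (Complex.I * k * ((2 * θ : ℝ) : ℂ)) * u x) +
      Complex.exp (-(Complex.I * θ)) / 2 *
        (Complex.exp (Complex.I * k * ((-(2 * θ) : ℝ) : ℂ)) * v x) := by
    intro k x
    rw [output_eq_groverVec P w0 C S hs hc, grover_iterate_linear,
      grover_iterate_groverVec P w0 C S hs hc, grover_iterate_groverVec P w0 C S hsn hc]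
    have h2 : (c : ℂ) - Complex.I * s = (c : ℂ) + Complex.I * ((-s : ℝ) : ℂ) := by
      push_cast
      ring
    rw [h2, he, hen, ← Complex.exp_nat_mul, ← Complex.exp_nat_mul, ← Complex.exp_nat_mul,
      ← Complex.exp_nat_mul]
    simp only [Pi.add_apply, Pi.smul_apply, smul_eq_mul]
    rw [← hu, ← hv]
    have h3 : (k : ℂ) * (((2 : ℕ) : ℂ) * (Complex.I * θ)) = Complex.I * k * ((2 * θ : ℝ) : ℂ) := by
      push_cast
      ring
    have h4 : (k : ℂ) * (((2 : ℕ) : ℂ) * -(Complex.I * θ))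
        = Complex.I * k * ((-(2 * θ) : ℝ) : ℂ) := by
      push_cast
      ring
    rw [h3, h4]
  have h2 : ∀ x, slice (output P (0, w0) (amplitudeCircuit V w0 C S)) y x =
      (Complex.exp (Complex.I * θ) * window α (2 * θ - 2 * Real.pi * (y : ℕ) / M) * u x +
        Complex.exp (-(Complex.I * θ)) * window α (-(2 * θ) - 2 * Real.pi * (y : ℕ) / M) * v x)
        / 2 := by
    intro x
    rw [slice_output_amplitudeCircuit, window_sub_grid, window_sub_grid]
    simp only [Matrix.mulVec, dotProduct, Finset.mul_sum, Finset.sum_mul, ← Finset.sum_add_distrib,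
      Finset.sum_div, h1, hV]
    refine Finset.sum_congr rfl fun k _ => ?_
    rw [show (invQFT M).1 y k = invQFTMatrix M y k from rfl]
    ring
  have hn1 : ‖Complex.exp (Complex.I * θ)‖ = 1 := by
    rw [mul_comm, Complex.norm_exp_ofReal_mul_I]
  have hn2 : ‖Complex.exp (-(Complex.I * θ))‖ = 1 := by
    rw [Complex.exp_neg, norm_inv, hn1, inv_one]
  set X := ‖window α (2 * θ - 2 * Real.pi * (y : ℕ) / M)‖ ^ 2 with hX
  set Y := ‖window α (-(2 * θ) - 2 * Real.pi * (y : ℕ) / M)‖ ^ 2 with hY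
  -- The bound `|p + q|² ≤ 2|p|² + 2|q|²` avoids the orthogonality of the two eigenvectors. The lost
  -- factor of two is the `2` in the failure bound `2 * ξ` of amplitude estimation.
  have h3 : ∀ x : Reg W b d, outcomeProb P (0, w0) (amplitudeCircuit V w0 C S) ((y, x.1), x.2) ≤
      X / 2 * ‖u x‖ ^ 2 + Y / 2 * ‖v x‖ ^ 2 := by
    intro x
    have h4 : output P (0, w0) (amplitudeCircuit V w0 C S) ((y, x.1), x.2) =
      slice (output P (0, w0) (amplitudeCircuit V w0 C S)) y x := rfl
    rw [outcomeProb, h4, h2, norm_div, Complex.norm_two]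
    have h5 := norm_add_le
      (Complex.exp (Complex.I * θ) * window α (2 * θ - 2 * Real.pi * (y : ℕ) / M) * u x)
      (Complex.exp (-(Complex.I * θ)) * window α (-(2 * θ) - 2 * Real.pi * (y : ℕ) / M) * v x)
    rw [norm_mul, norm_mul, norm_mul, norm_mul, hn1, hn2, one_mul, one_mul] at h5
    have h6 := pow_le_pow_left₀ (norm_nonneg _) h5 2
    have h7 := sq_nonneg (‖window α (2 * θ - 2 * Real.pi * (y : ℕ) / M)‖ * ‖u x‖ -
      ‖window α (-(2 * θ) - 2 * Real.pi * (y : ℕ) / M)‖ * ‖v x‖)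
    rw [div_pow, hX, hY]
    linarith
  refine (Finset.sum_le_sum fun x _ => h3 x).trans ?_
  rw [Finset.sum_add_distrib, ← Finset.mul_sum, ← Finset.mul_sum]
  have h4 := mul_le_mul_of_nonneg_left (sum_norm_sq_groverVec_le P w0 C S hs hc)
    (by positivity : 0 ≤ X / 2)
  have h5 := mul_le_mul_of_nonneg_left (sum_norm_sq_groverVec_le P w0 C S hsn hc)
    (by positivity : 0 ≤ Y / 2)
  linarith

/-- The distance of `sin²(πy/M)` from `sin² θ`. -/
theorem abs_sin_sq_sub_le {x θ τ : ℝ} (z : ℤ) (h : |2 * θ - 2 * x - 2 * Real.pi * z| ≤ τ) :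
    |Real.sin x ^ 2 - Real.sin θ ^ 2| ≤ τ := by
  have h1 : Real.cos (2 * x) = Real.cos (2 * x + z * (2 * Real.pi)) :=
    (Real.cos_add_int_mul_two_pi _ _).symm
  have h2 := Real.abs_cos_sub_cos_le (2 * θ) (2 * x + z * (2 * Real.pi))
  have h3 : 2 * θ - (2 * x + z * (2 * Real.pi)) = 2 * θ - 2 * x - 2 * Real.pi * z := by ring
  rw [h3, ← h1] at h2
  have h4 : Real.sin x ^ 2 - Real.sin θ ^ 2 = (Real.cos (2 * θ) - Real.cos (2 * x)) / 2 := by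
    rw [Real.cos_two_mul, Real.cos_two_mul, Real.cos_sq', Real.cos_sq']
    ring
  rw [h4, abs_div, abs_two]
  linarith [abs_nonneg (Real.cos (2 * θ) - Real.cos (2 * x))]

open Classical in
/-- Amplitude estimation with a window of resolution `τ` errs by more than `τ` with small
probability. -/
theorem amplitude_failure_le [NeZero M] (P : Problem D d b a)
    (α : Fin M → ℂ) (hα : ∑ k, ‖α k‖ ^ 2 = 1) {τ ξ : ℝ} (hres : HasResolution α τ ξ)
    (V : Matrix.unitaryGroup (Fin M) ℂ) (hV : ∀ k, V.1 k 0 = α k) (w0 : W)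
    (C : Circuit W b d) (S : Reg W b d → Bool) :
    ∑ x : Reg (Fin M × W) b d,
      (if |Real.sin (Real.pi * (x.1.1 : ℕ) / M) ^ 2 - goodProb P w0 C S| ≤ τ then 0 else
        outcomeProb P (0, w0) (amplitudeCircuit V w0 C S) x) ≤ 2 * ξ := by
  set p := goodProb P w0 C S with hp
  set θ := Real.arcsin (Real.sqrt p) with hθ
  have hs : Real.sin θ ^ 2 = p := by
    rw [hθ, Real.sin_arcsin, Real.sq_sqrt (goodProb_nonneg P w0 C S)]
    · linarith [Real.sqrt_nonneg p]
    · exact Real.sqrt_le_one.mpr (goodProb_le_one P w0 C S)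
  rw [hasResolution_iff hα] at hres
  have h1 : ∀ y : Fin M, ∑ x : Reg W b d,
      (if |Real.sin (Real.pi * (y : ℕ) / M) ^ 2 - p| ≤ τ then 0 else
        outcomeProb P (0, w0) (amplitudeCircuit V w0 C S) ((y, x.1), x.2)) ≤
      (if ∃ z : ℤ, |2 * θ - 2 * Real.pi * (y : ℕ) / M - 2 * Real.pi * z| ≤ τ then 0 else
        ‖window α (2 * θ - 2 * Real.pi * (y : ℕ) / M)‖ ^ 2) +
      (if ∃ z : ℤ, |-(2 * θ) - 2 * Real.pi * (y : ℕ) / M - 2 * Real.pi * z| ≤ τ then 0 else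
        ‖window α (-(2 * θ) - 2 * Real.pi * (y : ℕ) / M)‖ ^ 2) := by
    intro y
    have hxy : 2 * Real.pi * (y : ℕ) / M = 2 * (Real.pi * (y : ℕ) / M) := by ring
    by_cases hE : |Real.sin (Real.pi * (y : ℕ) / M) ^ 2 - p| ≤ τ
    · simp only [hE, if_true, Finset.sum_const_zero]
      refine add_nonneg ?_ ?_ <;> split_ifs <;> positivity
    -- The eigenphases are `± 2θ`, and `sin²` does not see the sign. A phase within `τ` of either
    -- would give an accurate estimate, so a failing outcome lies in both tails.
    · have h2 : ¬ ∃ z : ℤ, |2 * θ - 2 * Real.pi * (y : ℕ) / M - 2 * Real.pi * z| ≤ τ := by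
        rintro ⟨z, hz⟩
        rw [hxy] at hz
        have := abs_sin_sq_sub_le z hz
        rw [hs] at this
        exact hE this
      have h3 : ¬ ∃ z : ℤ, |-(2 * θ) - 2 * Real.pi * (y : ℕ) / M - 2 * Real.pi * z| ≤ τ := by
        rintro ⟨z, hz⟩
        rw [hxy, ← mul_neg] at hz
        have := abs_sin_sq_sub_le z hz
        rw [Real.sin_neg, neg_sq, hs] at this
        exact hE this
      simp only [hE, if_false, h2, h3]
      exact sum_outcomeProb_amplitudeCircuit_le P α V hV w0 C S hs y
  have h2 := hres (2 * θ)
  have h3 := hres (-(2 * θ))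
  rw [windowTail] at h2 h3
  have h4 := Finset.sum_le_sum fun y (_ : y ∈ Finset.univ) => h1 y
  rw [Finset.sum_add_distrib] at h4
  rw [← (Equiv.prodAssoc (Fin M) W _).symm.sum_comp, Fintype.sum_prod_type]
  simp only [Equiv.prodAssoc_symm_apply]
  linarith

/-! Query counts of amplitude estimation. -/

/-- One initial run, then `M` steps with one run of the circuit and one of its inverse each; the
hypotheses on `q` and `q'` say that the counter ignores inversion, the phase register and free
gates. -/
theorem countP_amplitudeCircuit (q : Gate W b d → Bool) (q' : Gate (Fin M × W) b d → Bool)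
    (hq : ∀ g, q g.inv = q g) (hq' : ∀ g, q' (g.lift M) = q g) (hf : ∀ U, q' (.free U) = false)
    (V : Matrix.unitaryGroup (Fin M) ℂ) (w0 : W) (C : Circuit W b d) (S : Reg W b d → Bool) :
    (amplitudeCircuit V w0 C S).countP q' = (2 * M + 1) * C.countP q := by
  have h1 : ∀ C : Circuit W b d, (liftCircuit M C).countP q' = C.countP q := by
    intro C
    rw [liftCircuit, List.countP_map]
    exact congrArg (fun f => List.countP f C) (funext hq')
  have h2 : (invCircuit C).countP q = C.countP q := by
    rw [invCircuit, List.countP_reverse, List.countP_map]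
    exact congrArg (fun f => List.countP f C) (funext hq)
  have h3 : ∀ k, (groverStep M w0 C S k).countP q' = 2 * C.countP q := by
    intro k
    rw [groverStep, List.countP_cons, List.countP_append, List.countP_cons, h1, h1, h2, hf, hf]
    simp
    ring
  rw [amplitudeCircuit, List.countP_cons, List.countP_append, List.countP_append,
    List.countP_flatMap, h1, List.countP_cons, List.countP_nil, hf, hf]
  simp only [Function.comp_def, h3, List.map_const', List.sum_replicate, List.length_range]
  simp
  ring

theorem evolQueries_amplitudeCircuit (V : Matrix.unitaryGroup (Fin M) ℂ) (w0 : W)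
    (C : Circuit W b d) (S : Reg W b d → Bool) :
    evolQueries (amplitudeCircuit V w0 C S) = (2 * M + 1) * evolQueries C :=
  countP_amplitudeCircuit _ _ (fun g => by cases g <;> rfl) (fun g => by cases g <;> rfl)
    (fun _ => rfl) V w0 C S

theorem blockQueries_amplitudeCircuit (j : Fin (D + 1)) (V : Matrix.unitaryGroup (Fin M) ℂ)
    (w0 : W) (C : Circuit W b d) (S : Reg W b d → Bool) :
    blockQueries j (amplitudeCircuit V w0 C S) = (2 * M + 1) * blockQueries j C :=
  countP_amplitudeCircuit _ _ (fun g => by cases g <;> rfl) (fun g => by cases g <;> rfl)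
    (fun _ => rfl) V w0 C S

theorem prepQueries_amplitudeCircuit (V : Matrix.unitaryGroup (Fin M) ℂ) (w0 : W)
    (C : Circuit W b d) (S : Reg W b d → Bool) :
    prepQueries (amplitudeCircuit V w0 C S) = (2 * M + 1) * prepQueries C :=
  countP_amplitudeCircuit _ _ (fun g => by cases g <;> rfl) (fun g => by cases g <;> rfl)
    (fun _ => rfl) V w0 C S

end lift

/-! ### Direct sampling -/

/-- Chebyshev's inequality, for the empirical frequencies of disjoint events simultaneously. -/
theorem eventProb_frequency_failure_le {X Y : Type} [Fintype X] [Fintype Y] {T : ℕ} (hT : 0 < T)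
    (p : X → ℝ) (hp0 : ∀ x, 0 ≤ p x) (hp : ∑ x, p x = 1) (s : Y → X → Bool) (q : Y → ℝ)
    (hq : ∀ y, q y = ∑ x, if s y x then p x else 0) (hq1 : ∑ y, q y ≤ 1) {τ : ℝ} (hτ : 0 < τ) :
    eventProb (fun _ : Fin T => p) (fun x => ¬ ∀ y,
      |((Finset.univ.filter fun t => s y (x t)).card : ℝ) / T - q y| ≤ τ) ≤ 1 / (T * τ ^ 2) := by
  have hTR : (0 : ℝ) < T := by exact_mod_cast hT
  set f : Y → X → ℝ := fun y x => (if s y x then 1 else 0) - q y with hf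
  have hf0 : ∀ y, ∑ x, p x * f y x = 0 := by
    intro y
    simp only [hf, mul_sub, mul_ite, mul_one, mul_zero, Finset.sum_sub_distrib, ← Finset.sum_mul,
      hp, one_mul, ← hq, sub_self]
  -- The variance of an indicator is `q (1 - q)`.
  have hf2 : ∀ y, ∑ x, p x * f y x ^ 2 ≤ q y := by
    intro y
    have h1 : ∀ x, p x * f y x ^ 2 = (if s y x then p x else 0) * (1 - 2 * q y) + p x * q y ^ 2 := by
      intro x
      simp only [hf]
      split_ifs <;> ring
    simp_rw [h1]
    rw [Finset.sum_add_distrib, ← Finset.sum_mul, ← Finset.sum_mul, ← hq, hp]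
    nlinarith [sq_nonneg (q y)]
  have hw : ∀ x : Fin T → X, 0 ≤ ∏ t, p (x t) := fun x => Finset.prod_nonneg fun t _ => hp0 _
  have hcard : ∀ (x : Fin T → X) y, ((Finset.univ.filter fun t => s y (x t)).card : ℝ) / T - q y
      = (∑ t, f y (x t)) / T := by
    intro x y
    simp only [hf, Finset.sum_sub_distrib, Finset.sum_boole, Finset.sum_const, Finset.card_univ,
      Fintype.card_fin, nsmul_eq_mul]
    field_simp
  -- Union bound and Markov's inequality at once: if some frequency fails, its normalised squared
  -- deviation alone is at least `1`.
  have h1 : eventProb (fun _ : Fin T => p) (fun x => ¬ ∀ y,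
      |((Finset.univ.filter fun t => s y (x t)).card : ℝ) / T - q y| ≤ τ) ≤
      ∑ x : Fin T → X, ∑ y, (∏ t, p (x t)) * (∑ t, f y (x t)) ^ 2 / (T * τ) ^ 2 := by
    refine Finset.sum_le_sum fun x _ => ?_
    have hn : ∀ y, 0 ≤ (∏ t, p (x t)) * (∑ t, f y (x t)) ^ 2 / (T * τ) ^ 2 := fun y =>
      div_nonneg (mul_nonneg (hw x) (sq_nonneg _)) (sq_nonneg _)
    by_cases h : ∀ y, |((Finset.univ.filter fun t => s y (x t)).card : ℝ) / T - q y| ≤ τ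
    · rw [if_neg (not_not.mpr h)]
      exact Finset.sum_nonneg fun y _ => hn y
    · rw [if_pos h]
      push Not at h
      obtain ⟨y, hy⟩ := h
      refine le_trans ?_ (Finset.single_le_sum (fun y _ => hn y) (Finset.mem_univ y))
      rw [hcard, abs_div, abs_of_pos hTR, lt_div_iff₀ hTR] at hy
      rw [mul_div_assoc]
      refine le_mul_of_one_le_right (hw x) ?_
      rw [one_le_div (by positivity), ← sq_abs (∑ t, f y (x t))]
      exact pow_le_pow_left₀ (by positivity) (by linarith) 2
  refine h1.trans ?_
  rw [Finset.sum_comm]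
  simp_rw [← Finset.sum_div, sum_prod_mul_sq_sum p (f _) hp (hf0 _)]
  rw [← Finset.mul_sum, div_le_div_iff₀ (by positivity) (by positivity)]
  -- Here `∑ y, q y ≤ 1` removes any dependence on the number of events.
  have h2 : ∑ y, ∑ x, p x * f y x ^ 2 ≤ 1 := (Finset.sum_le_sum fun y _ => hf2 y).trans hq1
  have h3 : (T : ℝ) * (∑ y, ∑ x, p x * f y x ^ 2) * (T * τ ^ 2)
      ≤ (T : ℝ) * 1 * (T * τ ^ 2) := by gcongr
  linarith

/-! ### Estimation of the response at one point and on the grid -/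

section estimation

variable {D d m : ℕ} {b : Fin (D + 1) → ℕ} [∀ j, NeZero (b j)]

/-- The outcomes with time registers `ω` and successful block-encodings. -/
def isSuccess (ω : Fin D → Fin (2 ^ m)) (x : Reg (Fin D → Fin (2 ^ m)) b d) : Bool :=
  x.1 = ω ∧ x.2.1 = fun _ => 0

theorem sum_isSuccess (f : Reg (Fin D → Fin (2 ^ m)) b d → ℝ) (ω : Fin D → Fin (2 ^ m)) :
    (∑ x, if isSuccess ω x then f x else 0) = ∑ s, f (ω, fun _ => 0, s) := by
  rw [Fintype.sum_prod_type, Finset.sum_eq_single ω, Fintype.sum_prod_type,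
    Finset.sum_eq_single fun _ => 0]
  · simp [isSuccess]
  · intro x _ hx
    simp [isSuccess, hx]
  · simp
  · intro w _ hw
    simp [isSuccess, hw]
  · simp

variable [NeZero d] {a : Fin (D + 1) → ℝ}

theorem R2_eq_goodProb (P : Problem D d b a) (ha : ∀ j, 0 < a j) (α : Fin (2 ^ m) → ℂ)
    (φ : Fin D → ℝ) (U : Matrix.unitaryGroup (Reg (Fin D → Fin (2 ^ m)) b d) ℂ)
    (hU : PreparesWindow α φ U) :
    P.R2 α φ = (∏ j, a j) ^ 2 *
      goodProb P (fun _ => 0) (responseCircuit b d U) (isSuccess fun _ => 0) := by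
  have h := R2_eq P ha α φ U hU fun _ => 0
  have h0 : gridFreq (fun _ : Fin D => (0 : Fin (2 ^ m))) = 0 := by
    funext i
    simp [gridFreq]
  rw [h0, add_zero] at h
  rw [h, goodProb, sum_isSuccess]

theorem R2_nonneg (P : Problem D d b a) {N : ℕ} (α : Fin N → ℂ) (φ : Fin D → ℝ) :
    0 ≤ P.R2 α φ := sq_nonneg _

/-- Together with nonnegativity this makes `0` an accurate estimate whenever `Ω² ≤ ε`. -/
theorem R2_le (P : Problem D d b a) (ha : ∀ j, 0 < a j) (α : Fin (2 ^ m) → ℂ)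
    (hα : ∑ k, ‖α k‖ ^ 2 = 1) (φ : Fin D → ℝ) : P.R2 α φ ≤ (∏ j, a j) ^ 2 := by
  obtain ⟨U, hU⟩ := exists_preparesWindow b d α hα φ
  rw [R2_eq_goodProb P ha α φ U hU]
  exact mul_le_of_le_one_right (sq_nonneg _) (goodProb_le_one P _ _ _)

theorem eventProb_fin_one {X : Type} [Fintype X] (p : X → ℝ) (E : (Fin 1 → X) → Prop)
    [∀ x, Decidable (E fun _ => x)] :
    eventProb (fun _ : Fin 1 => p) E = ∑ x, if E fun _ => x then p x else 0 := by
  rw [eventProb, ← (Equiv.funUnique (Fin 1) X).symm.sum_comp]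
  refine Finset.sum_congr rfl fun x _ => ?_
  have : (Equiv.funUnique (Fin 1) X).symm x = fun _ => x := rfl
  simp only [this, Finset.univ_unique, Finset.prod_const, Finset.card_singleton, pow_one]

theorem successProb_of_samples_zero (A : Procedure b d) (hA : A.samples = 0) (P : Problem D d b a)
    {r ε : ℝ} (h : ∀ x, |A.estimate x - r| ≤ ε) : A.successProb P r ε = 1 :=
  eventProb_of_forall _ (fun t => absurd t.2 (by omega)) _ h

/-- Estimation of the response at one point by amplitude estimation. -/
theorem exists_procedure_point (ha : ∀ j, 0 < a j) (α : Fin (2 ^ m) → ℂ)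
    (hα : ∑ k, ‖α k‖ ^ 2 = 1) (φ : Fin D → ℝ) {δ ε : ℝ} (hδ : 0 < δ) (hδ1 : δ < 1) (hε : 0 < ε) :
    ∃ A : Procedure b d, A.samples ≤ 1 ∧ ∃ Q : ℝ, 0 ≤ Q ∧
      Q ≤ 120 * (Real.log (2 / δ) + 1) * ((∏ j, a j) ^ 2 / ε) ∧
      (∑ t, (evolQueries (A.circuit t) : ℝ)) ≤ Q * (D * (2 * 2 ^ m)) ∧
      (∀ j, (∑ t, (blockQueries j (A.circuit t) : ℝ)) ≤ Q) ∧
      (∑ t, (prepQueries (A.circuit t) : ℝ)) ≤ Q ∧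
      ∀ P : Problem D d b a, 1 - δ ≤ A.successProb P (P.R2 α φ) ε := by
  set Ω := ∏ j, a j with hΩ
  have hΩpos : 0 < Ω := Finset.prod_pos fun j _ => ha j
  have hlog : 0 ≤ Real.log (2 / δ) := Real.log_nonneg (by rw [le_div_iff₀ hδ]; linarith)
  -- In the first case no query is needed. In the second the required accuracy `ε / Ω²` for the
  -- probability is below `1`, as the existence of the window demands.
  rcases le_or_gt (Ω ^ 2) ε with hsmall | hlarge
  · let A : Procedure b d :=
      { W := Unit, w0 := (), samples := 0, circuit := fun _ => [], estimate := fun _ => 0 }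
    refine ⟨A, Nat.zero_le _, 0, le_rfl, by positivity, by simp [A], by simp [A], by simp [A],
      fun P => ?_⟩
    rw [successProb_of_samples_zero A rfl P]
    · linarith
    · intro x
      change |0 - P.R2 α φ| ≤ ε
      rw [zero_sub, abs_neg, abs_of_nonneg (R2_nonneg P α φ)]
      exact (R2_le P ha α hα φ).trans hsmall
  · have hτ : 0 < ε / Ω ^ 2 := by positivity
    have hτ1 : ε / Ω ^ 2 < 1 := by rwa [div_lt_one (by positivity)]
    -- Each of the two eigenphases may fail with weight `δ / 2`.
    obtain ⟨μ, β, hβ, hres, hμ⟩ := exists_hasResolution hτ hτ1 (half_pos hδ) (by linarith)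
    obtain ⟨V, hV⟩ := exists_unitary_column β hβ
    obtain ⟨U, hU⟩ := exists_preparesWindow b d α hα φ
    set C := amplitudeCircuit V (fun _ => 0) (responseCircuit b d U) (isSuccess fun _ => 0) with hC
    let A : Procedure b d :=
      { W := Fin (2 ^ μ) × (Fin D → Fin (2 ^ m))
        w0 := (0, fun _ => 0)
        samples := 1
        circuit := fun _ => C
        estimate := fun x => Ω ^ 2 * Real.sin (Real.pi * ((x 0).1.1 : ℕ) / (2 ^ μ : ℕ)) ^ 2 }
    have hM1 : (1 : ℝ) ≤ 2 ^ μ := one_le_pow₀ (by norm_num)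
    -- The number of runs is `2 * 2 ^ μ + 1 ≤ 3 * 2 ^ μ`, which turns the `40` of the window into
    -- `120`.
    refine ⟨A, le_rfl, 2 * 2 ^ μ + 1, by positivity, ?_, ?_, fun j => ?_, ?_, fun P => ?_⟩
    · have h1 : 40 * (Real.log (1 / (δ / 2)) + 1) / (ε / Ω ^ 2)
          = 40 * (Real.log (2 / δ) + 1) * (Ω ^ 2 / ε) := by
        rw [one_div_div]
        field_simp
      rw [h1] at hμ
      linarith
    · have h1 : ∑ t, (evolQueries (A.circuit t) : ℝ) = evolQueries C := by simp [A]
      rw [h1, hC, evolQueries_amplitudeCircuit, evolQueries_responseCircuit]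
      have h2 : ((2 ^ m - 1 : ℕ) : ℝ) ≤ 2 ^ m := by
        exact_mod_cast Nat.sub_le (2 ^ m) 1
      push_cast
      gcongr
    · have h1 : ∑ t, (blockQueries j (A.circuit t) : ℝ) = blockQueries j C := by simp [A]
      rw [h1, hC, blockQueries_amplitudeCircuit, blockQueries_responseCircuit]
      push_cast
      linarith
    · have h1 : ∑ t, (prepQueries (A.circuit t) : ℝ) = prepQueries C := by simp [A]
      rw [h1, hC, prepQueries_amplitudeCircuit, prepQueries_responseCircuit]
      push_cast
      linarith
    · set p := goodProb P (fun _ => 0) (responseCircuit b d U) (isSuccess fun _ => 0) with hp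
      have hfail := amplitude_failure_le P β hβ hres V hV (fun _ => 0) (responseCircuit b d U)
        (isSuccess fun _ => 0)
      have h1 : eventProb (fun _ : Fin 1 => outcomeProb P (0, fun _ => 0) C)
          (fun x => ¬ |Ω ^ 2 * Real.sin (Real.pi * ((x 0).1.1 : ℕ) / (2 ^ μ : ℕ)) ^ 2
            - P.R2 α φ| ≤ ε) ≤ δ := by
        rw [eventProb_fin_one]
        refine le_trans (le_of_eq (Finset.sum_congr rfl fun x _ => ?_)) (hfail.trans (by linarith))
        have h2 : |Ω ^ 2 * Real.sin (Real.pi * (x.1.1 : ℕ) / (2 ^ μ : ℕ)) ^ 2 - P.R2 α φ| ≤ ε ↔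
            |Real.sin (Real.pi * (x.1.1 : ℕ) / (2 ^ μ : ℕ)) ^ 2 - p| ≤ ε / Ω ^ 2 := by
          rw [R2_eq_goodProb P ha α φ U hU, ← mul_sub, abs_mul, abs_of_pos (by positivity),
            le_div_iff₀' (by positivity)]
        rw [ite_not]
        exact if_congr h2 rfl rfl
      have h2 := eventProb_add_eventProb_not
        (fun _ : Fin 1 => outcomeProb P (0, fun _ => 0) C)
        (fun _ => sum_outcomeProb P _ C)
        (fun x => |Ω ^ 2 * Real.sin (Real.pi * ((x 0).1.1 : ℕ) / (2 ^ μ : ℕ)) ^ 2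
            - P.R2 α φ| ≤ ε)
      change 1 - δ ≤ eventProb (fun _ : Fin 1 => outcomeProb P (0, fun _ => 0) C)
        (fun x => |Ω ^ 2 * Real.sin (Real.pi * ((x 0).1.1 : ℕ) / (2 ^ μ : ℕ)) ^ 2
            - P.R2 α φ| ≤ ε)
      linarith

/-- Estimation of the response on the whole grid by direct sampling. -/
theorem exists_samples_grid (ha : ∀ j, 0 < a j) (α : Fin (2 ^ m) → ℂ)
    (hα : ∑ k, ‖α k‖ ^ 2 = 1) (UL : Matrix.unitaryGroup (Fin (2 ^ m)) ℂ)
    (hUL : ∀ k, UL.1 k 0 = α k) {δ ε : ℝ} (hδ : 0 < δ) (hε : 0 < ε) :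
    ∃ M : ℕ, (M : ℝ) ≤ (1 / δ + 1) * ((∏ j, a j) ^ 4 / ε ^ 2) ∧
      ∀ P : Problem D d b a,
        1 - δ ≤ eventProb (fun _ : Fin M => outcomeProb P (fun _ => 0) (squareCircuit b d UL))
          fun x => ∀ ω : Fin D → Fin (2 ^ m),
            |sampleEstimate (∏ j, a j) x ω - P.R2 α (gridFreq ω)| ≤ ε := by
  set Ω := ∏ j, a j with hΩ
  have hΩpos : 0 < Ω := Finset.prod_pos fun j _ => ha j
  rcases le_or_gt (Ω ^ 2) ε with hsmall | hlarge
  · refine ⟨0, by simp only [Nat.cast_zero]; positivity, fun P => ?_⟩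
    rw [eventProb_of_forall _ fun _ => sum_outcomeProb P _ _]
    · linarith
    · intro x ω
      -- With no samples the quotient by `0` is `0`, which is the trivial estimate.
      rw [sampleEstimate, Nat.cast_zero, div_zero, zero_sub, abs_neg,
        abs_of_nonneg (R2_nonneg P α _)]
      exact (R2_le P ha α hα _).trans hsmall
  · set B := Ω ^ 4 / ε ^ 2 with hB
    -- This absorbs the rounding of the number of samples into the constant.
    have hB1 : 1 ≤ B := by
      rw [hB, one_le_div (by positivity)]
      calc ε ^ 2 ≤ (Ω ^ 2) ^ 2 := pow_le_pow_left₀ hε.le hlarge.le 2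
        _ = Ω ^ 4 := by ring
    have hMpos : 0 < ⌈1 / δ * B⌉₊ := Nat.ceil_pos.mpr (by positivity)
    refine ⟨⌈1 / δ * B⌉₊, ?_, fun P => ?_⟩
    · refine (Nat.ceil_lt_add_one (by positivity)).le.trans ?_
      linarith
    · set M := ⌈1 / δ * B⌉₊ with hM
      have hMR : 1 / δ * B ≤ M := Nat.le_ceil _
      have hMR0 : (0 : ℝ) < M := by exact_mod_cast hMpos
      set p := outcomeProb P (fun _ => 0) (squareCircuit b d UL) with hp
      have hp1 : ∑ x, p x = 1 := sum_outcomeProb P _ _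
      have hp0 : ∀ x, 0 ≤ p x := fun x => sq_nonneg _
      have hq : ∀ ω : Fin D → Fin (2 ^ m),
          squareProb P UL ω = ∑ x, if isSuccess ω x then p x else 0 := fun ω =>
        (sum_isSuccess (fun x => p x) ω).symm
      have hq1 : ∑ ω, squareProb P UL ω ≤ 1 := by
        simp_rw [hq]
        rw [Finset.sum_comm, ← hp1]
        refine Finset.sum_le_sum fun x _ => ?_
        rw [Finset.sum_eq_single x.1]
        · split_ifs
          · exact le_rfl
          · exact hp0 x
        · intro ω _ hω
          rw [if_neg]
          simp [isSuccess, Ne.symm hω]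
        · simp
      have hτ : 0 < ε / Ω ^ 2 := by positivity
      have hcheb := eventProb_frequency_failure_le hMpos p hp0 hp1
        isSuccess (squareProb P UL) hq hq1 hτ
      have hE : (fun x : Fin M → Reg (Fin D → Fin (2 ^ m)) b d => ∀ ω : Fin D → Fin (2 ^ m),
          |((Finset.univ.filter fun t => isSuccess ω (x t)).card : ℝ) / M -
            squareProb P UL ω| ≤ ε / Ω ^ 2) = fun x => ∀ ω : Fin D → Fin (2 ^ m),
            |sampleEstimate Ω x ω - P.R2 α (gridFreq ω)| ≤ ε := by
        funext x
        refine propext (forall_congr' fun ω => ?_)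
        have hset : (Finset.univ.filter fun t => (x t).1 = ω ∧ (x t).2.1 = fun _ => 0)
            = Finset.univ.filter fun t => isSuccess ω (x t) := by
          ext t
          simp [isSuccess]
        rw [squareProb_eq P ha α UL hUL, sampleEstimate, ← hset, mul_div_assoc, ← mul_sub, abs_mul,
          abs_of_pos (by positivity : 0 < Ω ^ 2), le_div_iff₀' (by positivity)]
      have hbound : 1 / (M * (ε / Ω ^ 2) ^ 2) ≤ δ := by
        rw [div_le_iff₀ (by positivity)]
        have h1 : 1 / δ * B * (ε / Ω ^ 2) ^ 2 * δ = 1 := by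
          rw [hB]
          field_simp
        calc 1 = 1 / δ * B * (ε / Ω ^ 2) ^ 2 * δ := h1.symm
          _ ≤ M * (ε / Ω ^ 2) ^ 2 * δ := by gcongr
          _ = δ * (M * (ε / Ω ^ 2) ^ 2) := by ring
      have hadd := eventProb_add_eventProb_not (fun _ : Fin M => p) (fun _ => hp1)
        (fun x => ∀ ω : Fin D → Fin (2 ^ m),
          |((Finset.univ.filter fun t => isSuccess ω (x t)).card : ℝ) / M -
            squareProb P UL ω| ≤ ε / Ω ^ 2)
      rw [← hE]
      linarith

end estimation

end GQPE

/-! ### Assembly of the constants -/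

theorem theorem2 :
    -- the constant depends only on the allowed failure probability
    ∀ δ : ℝ, 0 < δ → δ < 1 → ∃ C : ℝ, 0 < C ∧
    ∀ (D : ℕ) (η ε : ℝ), 0 < η → η < 1 → 0 < ε → ε < 1 →
    -- there are windows of energy resolution `η` with `Õ(1/η)` Fourier terms
    (∃ (m : ℕ) (α : Fin (2 ^ m) → ℂ), ∑ k, ‖α k‖ ^ 2 = 1 ∧
      GQPE.HasResolution α η (ε / (D + 1)) ∧
      (2 ^ m : ℝ) ≤ C * Real.log (2 * (D + 1) / ε) / η) ∧
    -- for every window with `Õ(1/η)` Fourier terms, for all sizes and normalisations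
    ∀ (K : ℝ) (m : ℕ) (α : Fin (2 ^ m) → ℂ), ∑ k, ‖α k‖ ^ 2 = 1 →
    (2 ^ m : ℝ) ≤ K * Real.log (2 * (D + 1) / ε) / η →
    ∀ (d : ℕ) [NeZero d] (b : Fin (D + 1) → ℕ) [∀ j, NeZero (b j)] (a : Fin (D + 1) → ℝ),
    (∀ j, 0 < a j) →
    -- measurement probability of the circuit with `D` frequency registers
    (∀ UL : Matrix.unitaryGroup (Fin (2 ^ m)) ℂ, (∀ k, UL.1 k 0 = α k) →
      ∀ (P : GQPE.Problem D d b a) (ω : Fin D → Fin (2 ^ m)),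
        P.R2 α (GQPE.gridFreq ω) = (∏ j, a j) ^ 2 * GQPE.squareProb P UL ω) ∧
    -- estimation at one point
    (∀ ω : Fin D → ℝ, ∃ A : GQPE.Procedure b d,
      (A.samples : ℝ) ≤ C ∧
      (∑ t, (GQPE.evolQueries (A.circuit t) : ℝ)) ≤
        C * K * (D * (∏ j, a j) ^ 2 / (η * ε)) * Real.log (2 * (D + 1) / ε) ∧
      (∀ j, (∑ t, (GQPE.blockQueries j (A.circuit t) : ℝ)) ≤ C * ((∏ j, a j) ^ 2 / ε)) ∧
      (∑ t, (GQPE.prepQueries (A.circuit t) : ℝ)) ≤ C * ((∏ j, a j) ^ 2 / ε) ∧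
      ∀ P : GQPE.Problem D d b a, 1 - δ ≤ A.successProb P (P.R2 α ω) ε) ∧
    -- estimation at all points by direct sampling
    (∀ UL : Matrix.unitaryGroup (Fin (2 ^ m)) ℂ, (∀ k, UL.1 k 0 = α k) →
      (GQPE.evolQueries (GQPE.squareCircuit b d UL) : ℝ) ≤
        C * K * (D / η) * Real.log (2 * (D + 1) / ε) ∧
      (∀ j, GQPE.blockQueries j (GQPE.squareCircuit b d UL) = 1) ∧
      GQPE.prepQueries (GQPE.squareCircuit b d UL) = 1 ∧
      ∃ M : ℕ,
        (M : ℝ) ≤ C * ((∏ j, a j) ^ 4 / ε ^ 2) ∧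
        (M * GQPE.evolQueries (GQPE.squareCircuit b d UL) : ℝ) ≤
          C * K * (D * (∏ j, a j) ^ 4 / (η * ε ^ 2)) * Real.log (2 * (D + 1) / ε) ∧
        ∀ P : GQPE.Problem D d b a,
          1 - δ ≤ GQPE.eventProb
            (fun _ : Fin M => GQPE.outcomeProb P (fun _ => 0) (GQPE.squareCircuit b d UL))
            fun x => ∀ ω : Fin D → Fin (2 ^ m),
              |GQPE.sampleEstimate (∏ j, a j) x ω - P.R2 α (GQPE.gridFreq ω)| ≤ ε) := by
  intro δ hδ hδ1
  have hlog : 0 ≤ Real.log (2 / δ) := Real.log_nonneg (by rw [le_div_iff₀ hδ]; linarith)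
  have hinv : 0 < 1 / δ := by positivity
  -- The two summands serve amplitude estimation and direct sampling. Both are doubled, because each
  -- time register needs evolution forwards and backwards.
  set C : ℝ := 240 * (Real.log (2 / δ) + 1) + 2 * (1 / δ + 1) with hC
  have hC1 : 240 * (Real.log (2 / δ) + 1) ≤ C := by rw [hC]; linarith
  have hC2 : 2 * (1 / δ + 1) ≤ C := by rw [hC]; linarith
  have hC3 : 240 ≤ C := by rw [hC]; linarith
  refine ⟨C, by linarith, fun D η ε hη hη1 hε hε1 => ⟨?_, ?_⟩⟩
  · have hD : (0 : ℝ) ≤ D := Nat.cast_nonneg D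
    obtain ⟨m, α, hα, hres, hm⟩ := GQPE.exists_hasResolution (ξ := ε / (D + 1)) hη hη1
      (by positivity) (by rw [div_le_one (by positivity)]; linarith)
    refine ⟨m, α, hα, hres, hm.trans ?_⟩
    have h1 : 0 ≤ Real.log ((D + 1) / ε) :=
      Real.log_nonneg (by rw [le_div_iff₀ hε]; linarith)
    -- The factor `2` inside the logarithm keeps it above `log 2 > 1/2`, so that it absorbs the
    -- additive `1` in the size of the window.
    have h2 : Real.log (2 * (D + 1) / ε) = Real.log 2 + Real.log ((D + 1) / ε) := by
      rw [mul_div_assoc, Real.log_mul (by norm_num) (by positivity)]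
    have h3 := Real.log_two_gt_d9
    rw [one_div_div, h2]
    gcongr ?_ / η
    calc 40 * (Real.log ((D + 1) / ε) + 1)
        ≤ 80 * (Real.log 2 + Real.log ((D + 1) / ε)) := by linarith
      _ ≤ C * (Real.log 2 + Real.log ((D + 1) / ε)) := by gcongr; linarith
  · intro K m α hα hK d _ b _ a ha
    have hΩpos : 0 < ∏ j, a j := Finset.prod_pos fun j _ => ha j
    set Ω := ∏ j, a j with hΩ
    set L := Real.log (2 * (D + 1) / ε) with hL
    have hD : (0 : ℝ) ≤ D := Nat.cast_nonneg D
    -- No sign of `K` is assumed; the bound on `2 ^ m` forces the product to be nonnegative.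
    have hT0 : 0 ≤ K * L / η := le_trans (by positivity) hK
    have hevol : (D : ℝ) * (2 * 2 ^ m) ≤ 2 * (D * (K * L / η)) := by
      have := mul_le_mul_of_nonneg_left hK hD
      linarith
    refine ⟨fun UL hUL P ω => GQPE.squareProb_eq P ha α UL hUL ω, fun ω => ?_, fun UL hUL => ?_⟩
    · obtain ⟨A, hA, Q, hQ0, hQ, h1, h2, h3, h4⟩ :=
        GQPE.exists_procedure_point (b := b) (d := d) ha α hα ω hδ hδ1 hε
      rw [← hΩ] at hQ
      have hQC : Q ≤ C / 2 * (Ω ^ 2 / ε) := hQ.trans (by gcongr; linarith)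
      have hQC' : Q ≤ C * (Ω ^ 2 / ε) := hQC.trans (by gcongr; linarith)
      refine ⟨A, ?_, ?_, fun j => (h2 j).trans hQC', h3.trans hQC', h4⟩
      · have : (A.samples : ℝ) ≤ 1 := by exact_mod_cast hA
        linarith
      · refine h1.trans ?_
        calc Q * (D * (2 * 2 ^ m)) ≤ C / 2 * (Ω ^ 2 / ε) * (2 * (D * (K * L / η))) := by gcongr
          _ = C * K * (D * Ω ^ 2 / (η * ε)) * L := by
            field_simp
    · have hq : (GQPE.evolQueries (GQPE.squareCircuit b d UL) : ℝ) ≤ 2 * (D * (K * L / η)) := by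
        rw [GQPE.squareCircuit_eq, GQPE.evolQueries_responseCircuit]
        have h2 : ((2 ^ m - 1 : ℕ) : ℝ) ≤ 2 ^ m := by exact_mod_cast Nat.sub_le (2 ^ m) 1
        refine le_trans ?_ hevol
        push_cast
        gcongr
      obtain ⟨M, hM, hP⟩ := GQPE.exists_samples_grid (b := b) (d := d) ha α hα UL hUL hδ hε
      rw [← hΩ] at hM
      refine ⟨hq.trans ?_, fun j => ?_, ?_, M, hM.trans ?_, ?_, hP⟩
      · calc 2 * (D * (K * L / η)) ≤ C * (D * (K * L / η)) := by gcongr; linarith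
          _ = C * K * (D / η) * L := by ring
      · rw [GQPE.squareCircuit_eq, GQPE.blockQueries_responseCircuit]
      · rw [GQPE.squareCircuit_eq, GQPE.prepQueries_responseCircuit]
      · gcongr
        linarith
      · calc (M : ℝ) * GQPE.evolQueries (GQPE.squareCircuit b d UL)
            ≤ ((1 / δ + 1) * (Ω ^ 4 / ε ^ 2)) * (2 * (D * (K * L / η))) := by gcongr
          _ = 2 * (1 / δ + 1) * ((Ω ^ 4 / ε ^ 2) * (D * (K * L / η))) := by ring
          _ ≤ C * ((Ω ^ 4 / ε ^ 2) * (D * (K * L / η))) := by gcongr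
          _ = C * K * (D * Ω ^ 4 / (η * ε ^ 2)) * L := by
            field_simp
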